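/- **Setting.** Let $\mathcal S,\mathcal I,\mathcal J$ be finite index sets of messages, encoders (channel inputs) and decoders (channel outputs). Let $\mathcal A\subset\mathcal S\times\mathcal I$ be an arbitrary access structure, where $(s,i)\in\mathcal A$ means that encoder $i$ has access to message $s$, and for each $j\in\mathcal J$ let $\mathcal D(j)\subset\mathcal S$ be the set of messages to be reproduced by decoder $j$. Let $\mathcal X_i$ ($i\in\mathcal I$) be finite alphabets, and let $\mathcal Y^n_j$ ($j\in\mathcal J$, $n\in\mathbb N$) be arbitrary measurable spaces. A general channel is an arbitrary sequence of conditional distributions $\mu_{Y^n_{\mathcal J}|X^n_{\mathcal I}}$ on $\prod_j\mathcal Y^n_j$ given $x_{\mathcal I}\in\prod_i\mathcal X_i^n$; no stationarity or memorylessness is assumed. Put $\mathcal I(s)=\{i:(s,i)\in\mathcal A\}$ and $\mathcal S(i)=\{s:(s,i)\in\mathcal A\}$; for $\mathcal I'\subset\mathcal I$ put $\mathcal S(\mathcal I')=\{s:\mathcal I(s)=\mathcal I'\}$; let $\mathfrak I=\{\mathcal I'\subset\mathcal I:\mathcal S(\mathcal I')\ne\emptyset\}$ and $\mathcal S^{\circ}(\mathcal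 I')=\bigcup_{\mathcal I''\in\mathfrak I,\ \mathcal I''\supsetneq\mathcal I'}\mathcal S(\mathcal I'')$. For a family $(v_s)_{s\in\mathcal S}$ and $\mathcal T\subset\mathcal S$ write $v_{\mathcal T}=(v_s)_{s\in\mathcal T}$. **Operational region.** A rate vector $(R_s)_{s\in\mathcal S}$ with all $R_s\ge 0$ is *achievable* if for every $n$ there are finite non-empty message sets $\mathcal M^{(n)}_s$, (possibly stochastic) encoders $\Phi^{(n)}_i:\prod_{s\in\mathcal S(i)}\mathcal M^{(n)}_s\to\mathcal X_i^n$ and (possibly stochastic) decoders $\Psi^{(n)}_j:\mathcal Y^n_j\to\prod_{s\in\mathcal D(j)}\mathcal M^{(n)}_s$, using mutually independent randomness, such that $\liminf_{n\to\infty}\frac1n\log_2|\mathcal M^{(n)}_s|\ge R_s$ for all $s$ and, for independent messages $M^{(n)}_s$ uniform on $\mathcal M^{(n)}_s$ and reproductions $\widehat M^{(n)}_{j,s}$ of $M^{(n)}_s$ by decoder $j$, $$\lim_{n\to\infty}\mathrm P\bigl(\widehat M^{(n)}_{j,s}\neq M^{(n)}_s\text{ for some }j\in\mathcal J,\ s\in\mathcal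 D(j)\bigr)=0 .$$ $\mathcal R_{\mathrm{OP}}\subset\mathbb R^{\mathcal S}$ is the closure of the set of achievable rate vectors. **Spectral entropies.** For pairs $(U_n,V_n)$ of random variables with $U_n$ discrete, let $h_n=\frac1n\log_2\frac1{\mu_{U_n|V_n}(U_n|V_n)}$ and set $\overline H(\boldsymbol U|\boldsymbol V)=\inf\{\theta\in\mathbb R:\lim_n\mathrm P(h_n>\theta)=0\}$ and $\underline H(\boldsymbol U|\boldsymbol V)=\sup\{\theta\in\mathbb R:\lim_n\mathrm P(h_n<\theta)=0\}$ in $[-\infty,\infty]$. **Spectral region.** $\mathcal R_{\mathrm{IT}}$ is the set of all $(R_s)_{s\in\mathcal S}\in\mathbb R^{\mathcal S}$ for which there exist real numbers $(r_s)_{s\in\mathcal S}$ and, for every $n$, random variables $Z^n_s$ ($s\in\mathcal S$) with countable alphabets and joint law $$p_{Z^n_{\mathcal S}}(z_{\mathcal S})=\prod_{\mathcal I'\in\mathfrak I}p_{Z^n_{\mathcal S(\mathcal I')}|Z^n_{\mathcal S^{\circ}(\mathcal I')}}\bigl(z_{\mathcal S(\mathcal I')}\,|\,z_{\mathcal S^{\circ}(\mathcal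 I')}\bigr),$$ and conditional distributions $\mu_{X^n_i|Z^n_{\mathcal S(i)}}$ ($i\in\mathcal I$), such that, when $(Z^n_{\mathcal S},X^n_{\mathcal I},Y^n_{\mathcal J})$ has joint law $\mu_{Y^n_{\mathcal J}|X^n_{\mathcal I}}\bigl[\prod_{i}\mu_{X^n_i|Z^n_{\mathcal S(i)}}\bigr]p_{Z^n_{\mathcal S}}$, $$R_s\ge0\quad(s\in\mathcal S),$$ $$\sum_{s\in\mathcal S'}(R_s+r_s)\le\underline H(\boldsymbol Z_{\mathcal S'}|\boldsymbol Z_{\mathcal S^{\circ}(\mathcal I')})\quad(\mathcal I'\in\mathfrak I,\ \emptyset\ne\mathcal S'\subset\mathcal S(\mathcal I')),$$ $$\sum_{s\in\mathcal D'}r_s\ge\overline H(\boldsymbol Z_{\mathcal D'}|\boldsymbol Y_j,\boldsymbol Z_{\mathcal D(j)\setminus\mathcal D'})\quad(j\in\mathcal J,\ \emptyset\ne\mathcal D'\subset\mathcal D(j)).$$ **Theorem.** $\mathcal R_{\mathrm{OP}}=\mathcal R_{\mathrm{IT}}$. -/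

import Mathlib

open MeasureTheory ProbabilityTheory Filter Topology

noncomputable section

namespace MultiChannel

universe u v

/-! ### Message access structures -/

section Access

variable {S I : Type*} [Fintype S] [Fintype I] [DecidableEq S] [DecidableEq I]

/-- `I(s)`: the encoders that have access to message `s`. -/
def encodersOf (A : Finset (S × I)) (s : S) : Finset I :=
  Finset.univ.filter fun i => (s, i) ∈ A

/-- `S(i)`: the messages to which encoder `i` has access. -/
def messagesAt (A : Finset (S × I)) (i : I) : Finset S :=
  Finset.univ.filter fun s => (s, i) ∈ A

/-- `S(I')`: the messages `s` whose set of encoders `I(s)` is exactly `I'`. -/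
def privateMessages (A : Finset (S × I)) (I' : Finset I) : Finset S :=
  Finset.univ.filter fun s => encodersOf A s = I'

/-- The family of all `I' ⊆ I` with `S(I') ≠ ∅`. -/
def accessFamily (A : Finset (S × I)) : Finset (Finset I) :=
  Finset.univ.filter fun I' => (privateMessages A I').Nonempty

/-- `S°(I')`: the union of all `S(I'')` over the members `I''` of the family with `I' ⊊ I''`. -/
def publicMessages (A : Finset (S × I)) (I' : Finset I) : Finset S :=
  ((accessFamily A).filter fun I'' => I' ⊂ I'').biUnion (privateMessages A)

end Access

/-! ### Information spectrum quantities -/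

section Spectrum

variable {Ω : ℕ → Type*} [∀ n, MeasurableSpace (Ω n)]

/-- Limit superior in probability, as an extended real number. -/
def pLimsup (μ : ∀ n, Measure (Ω n)) (U : ∀ n, Ω n → ℝ) : EReal :=
  sInf ((fun θ : ℝ => (θ : EReal)) ''
    {θ : ℝ | Tendsto (fun n => μ n {ω | θ < U n ω}) atTop (𝓝 0)})

/-- Limit inferior in probability, as an extended real number. -/
def pLiminf (μ : ∀ n, Measure (Ω n)) (U : ∀ n, Ω n → ℝ) : EReal :=
  sSup ((fun θ : ℝ => (θ : EReal)) ''
    {θ : ℝ | Tendsto (fun n => μ n {ω | U n ω < θ}) atTop (𝓝 0)})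

variable {α β : ℕ → Type*} [∀ n, MeasurableSpace (α n)] [∀ n, StandardBorelSpace (α n)]
  [∀ n, Nonempty (α n)] [∀ n, MeasurableSpace (β n)]

/-- The normalized conditional self-information `(1/n) log₂ (1 / μ_{Uₙ|Vₙ}(Uₙ|Vₙ))`
of a discrete random variable `Uₙ` given an arbitrary random variable `Vₙ`. -/
def condInfo (μ : ∀ n, Measure (Ω n)) [∀ n, IsFiniteMeasure (μ n)]
    (U : ∀ n, Ω n → α n) (V : ∀ n, Ω n → β n) (n : ℕ) (ω : Ω n) : ℝ :=
  (1 / (n : ℝ)) *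
    Real.logb 2 (1 / (condDistrib (U n) (V n) (μ n) (V n ω)).real {U n ω})

/-- Spectral conditional sup-entropy rate. -/
def supEntropy (μ : ∀ n, Measure (Ω n)) [∀ n, IsFiniteMeasure (μ n)]
    (U : ∀ n, Ω n → α n) (V : ∀ n, Ω n → β n) : EReal :=
  pLimsup μ (condInfo μ U V)

/-- Spectral conditional inf-entropy rate. -/
def infEntropy (μ : ∀ n, Measure (Ω n)) [∀ n, IsFiniteMeasure (μ n)]
    (U : ∀ n, Ω n → α n) (V : ∀ n, Ω n → β n) : EReal :=
  pLiminf μ (condInfo μ U V)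

end Spectrum

/-! ### The channel, codes and the operational capacity region -/

section Region

variable {S I J : Type*} [Fintype S] [Fintype I] [Fintype J] [DecidableEq S] [DecidableEq I]

/-- A general channel: for each block length `n` a conditional distribution of the outputs
`Y^n_j` given the inputs `X^n_i ∈ (X i)^n`. There is no relation between different `n`. -/
abbrev Channel (X : I → Type u) (Y : ℕ → J → Type v) [∀ n j, MeasurableSpace (Y n j)] :=
  ∀ n, (∀ i, Fin n → X i) → ProbabilityMeasure (∀ j, Y n j)

/-- A (possibly stochastic) code of block length `n`. Message `s` takes values in a set of
`size s` elements, encoder `i` maps the messages in `S(i)` to a random channel input,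
and decoder `j` maps its channel output to a random reproduction of the messages in `D j`. -/
structure Code (A : Finset (S × I)) (D : J → Finset S) (X : I → Type u) (Y : ℕ → J → Type v)
    [∀ n j, MeasurableSpace (Y n j)] (n : ℕ) where
  size : S → ℕ
  size_pos : ∀ s, 0 < size s
  enc : ∀ i, (∀ s : messagesAt A i, Fin (size s)) → PMF (Fin n → X i)
  dec : ∀ j, Kernel (Y n j) (∀ s : D j, Fin (size s))
  dec_markov : ∀ j, IsMarkovKernel (dec j)

/-- The probability that some decoder reproduces one of its messages incorrectly, when the
messages are independent and uniform, and the encoders and the decoders use independent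
randomness. -/
def Code.errorProb {A : Finset (S × I)} {D : J → Finset S} {X : I → Type u}
    {Y : ℕ → J → Type v} [∀ i, Fintype (X i)] [∀ n j, MeasurableSpace (Y n j)] {n : ℕ}
    (C : Code A D X Y n) (W : Channel X Y) : ENNReal :=
  ∑ m : (∀ s, Fin (C.size s)), (∏ s, (C.size s : ENNReal)⁻¹) *
    ∑ x : (∀ i, Fin n → X i), (∏ i, C.enc i ((messagesAt A i).restrict m) (x i)) *
      ∫⁻ y, Measure.pi (fun j => C.dec j (y j))
        {mhat | ∃ j, ∃ s : D j, mhat j s ≠ m s} ∂(W n x : Measure (∀ j, Y n j))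

/-- Achievability of a vector of (nonnegative) rates. -/
def IsAchievable {X : I → Type u} {Y : ℕ → J → Type v} [∀ i, Fintype (X i)]
    [∀ n j, MeasurableSpace (Y n j)] (A : Finset (S × I)) (D : J → Finset S)
    (W : Channel X Y) (R : S → ℝ) : Prop :=
  (∀ s, 0 ≤ R s) ∧
  ∃ C : ∀ n, Code A D X Y n,
    (∀ s, (R s : EReal) ≤
      liminf (fun n : ℕ => ((Real.logb 2 ((C n).size s) / (n : ℝ) : ℝ) : EReal)) atTop) ∧
    Tendsto (fun n => (C n).errorProb W) atTop (𝓝 0)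

/-- The capacity region: the closure of the set of achievable rate vectors. -/
def ROP {X : I → Type u} {Y : ℕ → J → Type v} [∀ i, Fintype (X i)]
    [∀ n j, MeasurableSpace (Y n j)] (A : Finset (S × I)) (D : J → Finset S)
    (W : Channel X Y) : Set (S → ℝ) :=
  closure {R | IsAchievable A D W R}

/-! ### The region given by spectral entropies -/

/-- Auxiliary general sources `Z_s` with countable alphabets, whose joint law factorizes along
the access structure, together with the conditional laws of the channel inputs `X^n_i` given
the sources `Z^n_s`, `s ∈ S(i)`. -/
structure AuxSources (A : Finset (S × I)) (X : I → Type u) where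
  /-- The alphabet of `Z^n_s`. -/
  Alph : ℕ → S → Type
  countable : ∀ n s, Countable (Alph n s)
  nonempty : ∀ n s, Nonempty (Alph n s)
  /-- The joint law of `Z^n_s`, `s ∈ S`. -/
  law : ∀ n, PMF (∀ s, Alph n s)
  /-- `p(z)` is the product over `I'` of `p(z_{S(I')} | z_{S°(I')})`, where a conditional
  probability is the quotient of the two marginal probabilities. -/
  factorizes : ∀ n z, law n z = ∏ I' ∈ accessFamily A,
    (law n).map (privateMessages A I' ∪ publicMessages A I').restrict
        ((privateMessages A I' ∪ publicMessages A I').restrict z) /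
      (law n).map (publicMessages A I').restrict ((publicMessages A I').restrict z)
  /-- The conditional law of `X^n_i` given `Z^n_s`, `s ∈ S(i)`. -/
  input : ∀ n i, (∀ s : messagesAt A i, Alph n s) → PMF (Fin n → X i)

namespace AuxSources

variable {A : Finset (S × I)} {X : I → Type u} (Z : AuxSources A X)

instance (n : ℕ) (s : S) : Countable (Z.Alph n s) := Z.countable n s

instance (n : ℕ) (s : S) : Nonempty (Z.Alph n s) := Z.nonempty n s

instance (n : ℕ) (s : S) : MeasurableSpace (Z.Alph n s) := ⊤

instance (n : ℕ) (s : S) : DiscreteMeasurableSpace (Z.Alph n s) := ⟨fun _ => trivial⟩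

variable {Y : ℕ → J → Type v} [∀ i, Fintype (X i)] [∀ n j, MeasurableSpace (Y n j)]

/-- The joint law of the sources and the channel outputs: the sum over all source values `z`
and all channel inputs `x` of `p(z) ∏ᵢ p(xᵢ | z_{S(i)}) · (δ_z ⊗ W(· | x))`. -/
def joint (W : Channel X Y) (n : ℕ) : Measure ((∀ s, Z.Alph n s) × (∀ j, Y n j)) :=
  Measure.sum fun z : (∀ s, Z.Alph n s) => Measure.sum fun x : (∀ i, Fin n → X i) =>
    (Z.law n z * ∏ i, Z.input n i ((messagesAt A i).restrict z) (x i)) •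
      (Measure.dirac z).prod (W n x : Measure (∀ j, Y n j))

instance (W : Channel X Y) (n : ℕ) : IsProbabilityMeasure (Z.joint W n) := by
  constructor
  have h1 : ∀ z : (∀ s, Z.Alph n s),
      (∑ x : (∀ i, Fin n → X i), ∏ i, Z.input n i ((messagesAt A i).restrict z) (x i)) = 1 := by
    intro z
    classical
    rw [← Fintype.prod_sum (fun i (a : Fin n → X i) =>
      Z.input n i ((messagesAt A i).restrict z) a)]
    refine Finset.prod_eq_one fun i _ => ?_
    rw [← tsum_fintype (L := .unconditional _)]
    exact PMF.tsum_coe _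
  simp only [joint, Measure.sum_apply _ MeasurableSet.univ, Measure.smul_apply, measure_univ,
    smul_eq_mul, mul_one, tsum_fintype, ← Finset.mul_sum, h1]
  exact PMF.tsum_coe _

end AuxSources

/-- The rate vectors for which there are auxiliary sources and numbers `r s` with
`∑_{s ∈ S'} (R s + r s) ≤ H̲(Z_{S'} | Z_{S°(I')})` and
`∑_{s ∈ D'} r s ≥ H̄(Z_{D'} | Y_j, Z_{D(j) ∖ D'})`. -/
def RIT {X : I → Type u} {Y : ℕ → J → Type v} [∀ i, Fintype (X i)]
    [∀ n j, MeasurableSpace (Y n j)] (A : Finset (S × I)) (D : J → Finset S)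
    (W : Channel X Y) : Set (S → ℝ) :=
  {R | (∀ s, 0 ≤ R s) ∧ ∃ (Z : AuxSources A X) (r : S → ℝ),
    (∀ I' ∈ accessFamily A, ∀ S' ⊆ privateMessages A I', S'.Nonempty →
      ((∑ s ∈ S', (R s + r s) : ℝ) : EReal) ≤
        infEntropy (Z.joint W) (fun _ ω => S'.restrict ω.1)
          (fun _ ω => (publicMessages A I').restrict ω.1)) ∧
    (∀ j, ∀ D' ⊆ D j, D'.Nonempty →
      supEntropy (Z.joint W) (fun _ ω => D'.restrict ω.1)
          (fun _ ω => (ω.2 j, (D j \ D').restrict ω.1)) ≤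
        ((∑ s ∈ D', r s : ℝ) : EReal))}

end Region

end MultiChannel

end

/-!
Achievability is closed under limits of rate vectors by a diagonal argument, so that `ROP` consists
of achievable rates. For the converse take the uniform messages themselves as the sources `Z` and
`r = 0`: their conditional self-information given public messages is the logarithm of the number of
messages, and a decoder that is correct with high probability forces the self-information given its
output to be small.

The direct part is a random binning argument. Each source `Z_s` gets a random bin number of which a
part of rate about `r s` is shared with the decoders and the rest, of rate about `R s`, is the
message. The encoders turn uniform bin numbers into sources, block by block from public to private
messages, with common random functions. The conditions on `infEntropy` make the bin numbers of each
block nearly uniform given its public sources, so that the sources generated from uniform bin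
numbers nearly follow the law of `Z`. A decoder looks for likely sources with the given shared parts
of the bin numbers; by the conditions on `supEntropy` only the true sources survive. Averaging fixes
the random functions and the shared parts. Messages that no decoder reproduces get rate zero in this
code, and any desired rate afterwards, since encoders may ignore them.
-/

noncomputable section

namespace MultiChannel

/-! ### Closedness of the achievable region -/

section Achievability

lemma exists_seq_eventually_of_forall_eventually {P : ℕ → ℝ → Prop}
    (h : ∀ ε > 0, ∀ᶠ n in atTop, P n ε) :
    ∃ e : ℕ → ℝ, (∀ᶠ n in atTop, P n (e n)) ∧ ∀ ε > 0, ∀ᶠ n in atTop, e n ≤ ε := by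
  classical
  let k : ℕ → ℕ := fun n => Nat.findGreatest (fun k => P n (1 / ((k : ℝ) + 1))) n
  refine ⟨fun n => 1 / ((k n : ℝ) + 1), ?_, fun ε hε => ?_⟩
  · filter_upwards [h (1 / ((0 : ℕ) + 1)) (by norm_num)] with n hn
    exact Nat.findGreatest_spec (P := fun k => P n (1 / ((k : ℝ) + 1))) (Nat.zero_le n) hn
  · obtain ⟨K, hK⟩ := exists_nat_one_div_lt hε
    filter_upwards [h (1 / ((K : ℝ) + 1)) (by positivity), eventually_ge_atTop K] with n hn hKn
    have hKk : (K : ℝ) ≤ k n := by exact_mod_cast Nat.le_findGreatest hKn hn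
    exact (one_div_le_one_div_of_le (by positivity) (by linarith)).trans hK.le

lemma eventually_forall_sub_lt_of_le_liminf {ι : Type*} [Finite ι] {R : ι → ℝ} {u : ℕ → ι → ℝ}
    (h : ∀ i, (R i : EReal) ≤ liminf (fun n => (u n i : EReal)) atTop) {ε : ℝ} (hε : 0 < ε) :
    ∀ᶠ n in atTop, ∀ i, R i - ε < u n i := by
  refine eventually_all.2 fun i => ?_
  have hlt : ((R i - ε : ℝ) : EReal) < liminf (fun n => (u n i : EReal)) atTop :=
    lt_of_lt_of_le (EReal.coe_lt_coe_iff.2 (sub_lt_self _ hε)) (h i)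
  filter_upwards [eventually_lt_of_lt_liminf hlt] with n hn
  exact EReal.coe_lt_coe_iff.1 hn

variable {S I J : Type*} [Fintype S] [DecidableEq S] [DecidableEq I]
  {X : I → Type*} {Y : ℕ → J → Type*} [∀ n j, MeasurableSpace (Y n j)]
  {A : Finset (S × I)} {D : J → Finset S}

lemma Code.nonempty_input {n : ℕ} (hn : n ≠ 0) (C : Code A D X Y n) (i : I) :
    Nonempty (X i) := by
  obtain ⟨x, -⟩ := (C.enc i fun s => ⟨0, C.size_pos s⟩).support_nonempty
  exact ⟨x ⟨0, Nat.pos_of_ne_zero hn⟩⟩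

lemma nonempty_code [∀ i, Nonempty (X i)] (n : ℕ) : Nonempty (Code A D X Y n) :=
  ⟨{ size := fun _ => 1
     size_pos := fun _ => one_pos
     enc := fun i _ => PMF.pure fun _ => Classical.arbitrary (X i)
     dec := fun _ => Kernel.const _ (Measure.dirac fun _ => 0)
     dec_markov := fun _ => inferInstance }⟩

variable [Fintype I] [Fintype J] [∀ i, Fintype (X i)] {W : Channel X Y} {R : S → ℝ}

/-- There is a code of block length `n` whose rates are at least `R s - ε` and whose error
probability is at most `ε`. Unlike achievability, this involves a single block length, so that
codes for approximate rates can be exchanged one block length at a time. -/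
def HasGoodCode (A : Finset (S × I)) (D : J → Finset S) (W : Channel X Y) (R : S → ℝ) (n : ℕ)
    (ε : ℝ) : Prop :=
  ∃ C : Code A D X Y n, (∀ s, R s - ε ≤ Real.logb 2 (C.size s) / (n : ℝ)) ∧
    C.errorProb W ≤ ENNReal.ofReal ε

lemma HasGoodCode.mono {R' : S → ℝ} {n : ℕ} {ε ε' : ℝ} (h : HasGoodCode A D W R n ε)
    (hR : ∀ s, R' s - ε' ≤ R s - ε) (hε : ε ≤ ε') : HasGoodCode A D W R' n ε' := by
  obtain ⟨C, hrate, herr⟩ := h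
  exact ⟨C, fun s => (hR s).trans (hrate s), herr.trans (ENNReal.ofReal_le_ofReal hε)⟩

lemma IsAchievable.eventually_hasGoodCode (h : IsAchievable A D W R) {ε : ℝ} (hε : 0 < ε) :
    ∀ᶠ n in atTop, HasGoodCode A D W R n ε := by
  obtain ⟨-, C, hrate, herr⟩ := h
  filter_upwards [eventually_forall_sub_lt_of_le_liminf hrate hε,
    herr.eventually_le_const (ENNReal.ofReal_pos.2 hε)] with n hn hn'
  exact ⟨C n, fun s => (hn s).le, hn'⟩

lemma exists_codes_of_eventually_hasGoodCode {e : ℕ → ℝ}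
    (h : ∀ᶠ n in atTop, HasGoodCode A D W R n (e n)) :
    ∃ C : ∀ n, Code A D X Y n, ∀ᶠ n in atTop,
      (∀ s, R s - e n ≤ Real.logb 2 ((C n).size s) / (n : ℝ)) ∧
        (C n).errorProb W ≤ ENNReal.ofReal (e n) := by
  classical
  have hX : ∀ i, Nonempty (X i) := by
    obtain ⟨n, ⟨C, -⟩, hn⟩ := (h.and (eventually_ne_atTop 0)).exists
    exact C.nonempty_input hn
  refine ⟨fun n => if hn : HasGoodCode A D W R n (e n) then hn.choose else (nonempty_code n).some,
    ?_⟩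
  filter_upwards [h] with n hn
  rw [dif_pos hn]
  exact hn.choose_spec

lemma isAchievable_of_eventually_hasGoodCode (hR : ∀ s, 0 ≤ R s)
    (h : ∀ ε > 0, ∀ᶠ n in atTop, HasGoodCode A D W R n ε) : IsAchievable A D W R := by
  obtain ⟨e, hgood, he⟩ := exists_seq_eventually_of_forall_eventually h
  obtain ⟨C, hC⟩ := exists_codes_of_eventually_hasGoodCode hgood
  refine ⟨hR, C, fun s => le_of_forall_lt fun a ha => ?_,
    ENNReal.tendsto_nhds_zero.2 fun δ hδ => ?_⟩
  · obtain ⟨c, hac, hcR⟩ := EReal.lt_iff_exists_real_btwn.1 ha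
    have hcR : 0 < R s - c := sub_pos.2 (EReal.coe_lt_coe_iff.1 hcR)
    refine hac.trans_le (le_liminf_of_le (by isBoundedDefault) ?_)
    filter_upwards [hC, he _ hcR] with n hn hen
    exact EReal.coe_le_coe_iff.2 (by linarith [hn.1 s])
  · obtain ⟨x, hx, hxδ⟩ := ENNReal.lt_iff_exists_nnreal_btwn.1 hδ
    filter_upwards [hC, he x (by exact_mod_cast hx)] with n hn hen
    calc (C n).errorProb W ≤ ENNReal.ofReal (e n) := hn.2
      _ ≤ ENNReal.ofReal x := ENNReal.ofReal_le_ofReal hen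
      _ ≤ δ := by rw [ENNReal.ofReal_coe_nnreal]; exact hxδ.le

lemma isAchievable_of_mem_ROP (h : R ∈ ROP A D W) : IsAchievable A D W R := by
  refine isAchievable_of_eventually_hasGoodCode (fun s => ?_) fun ε hε => ?_
  · have hcl : IsClosed {R : S → ℝ | 0 ≤ R s} := isClosed_le continuous_const (continuous_apply s)
    exact closure_minimal (fun R hR => hR.1 s) hcl h
  · obtain ⟨R', hR', hd⟩ := Metric.mem_closure_iff.1 h (ε / 2) (half_pos hε)
    filter_upwards [IsAchievable.eventually_hasGoodCode hR' (half_pos hε)] with n hn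
    refine hn.mono (fun s => ?_) (half_le_self hε.le)
    linarith [(abs_lt.1 ((dist_le_pi_dist R R' s).trans_lt hd)).2]

end Achievability

/-! ### Auxiliary sources -/

section Marginals

lemma tsum_map_mul {α β : Type*} (p : PMF α) (f : α → β) (g : β → ENNReal) :
    ∑' y, p.map f y * g y = ∑' x, p x * g (f x) := by
  classical
  simp only [PMF.map_apply, ← ENNReal.tsum_mul_right]
  rw [ENNReal.tsum_comm]
  exact tsum_congr fun x => (tsum_eq_single (f x) fun y hy => by simp [hy]).trans (by simp)

lemma apply_le_map_apply {α β : Type*} (p : PMF α) (f : α → β) (x : α) :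
    p x ≤ p.map f (f x) := by
  classical
  rw [PMF.map_apply]
  exact le_of_eq_of_le (by simp) (ENNReal.le_tsum x)

variable {S : Type*} {Alph : S → Type*} (p : PMF (∀ s, Alph s)) (T : Finset S)
  (z : ∀ s, Alph s)

/-- The marginal probability `p_{Z_T}(z_T)`. -/
def marg : ENNReal :=
  p.map T.restrict (T.restrict z)

lemma marg_ne_top : marg p T z ≠ ⊤ := PMF.apply_ne_top _ _

lemma apply_le_marg : p z ≤ marg p T z := apply_le_map_apply p T.restrict z

variable {p z} in
lemma marg_ne_zero (hz : p z ≠ 0) : marg p T z ≠ 0 :=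
  (pos_iff_ne_zero.2 hz |>.trans_le (apply_le_marg p T z)).ne'

end Marginals

section AccessStructure

variable {S I : Type*} [Fintype S] [Fintype I] [DecidableEq S] [DecidableEq I]

lemma prod_accessFamily {M : Type*} [CommMonoid M] (A : Finset (S × I)) (f : S → M) :
    ∏ I' ∈ accessFamily A, ∏ s ∈ privateMessages A I', f s = ∏ s, f s :=
  Finset.prod_fiberwise_of_maps_to
    (fun s _ => Finset.mem_filter.2 ⟨Finset.mem_univ _, s, by simp [privateMessages]⟩) f

lemma disjoint_privateMessages_publicMessages (A : Finset (S × I)) (I' : Finset I) :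
    Disjoint (privateMessages A I') (publicMessages A I') := by
  refine Finset.disjoint_left.2 fun s hs hs' => ?_
  simp only [privateMessages, publicMessages, Finset.mem_filter, Finset.mem_univ, true_and,
    Finset.mem_biUnion] at hs hs'
  obtain ⟨I'', ⟨-, hlt⟩, hs''⟩ := hs'
  exact hlt.ne (hs.symm.trans hs'')

end AccessStructure

section Spectrum

lemma tendsto_of_lt_pLiminf {Ω : ℕ → Type*} [∀ n, MeasurableSpace (Ω n)]
    {μ : ∀ n, Measure (Ω n)} {f : ∀ n, Ω n → ℝ} {θ : ℝ} (h : (θ : EReal) < pLiminf μ f) :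
    Tendsto (fun n => μ n {ω | f n ω < θ}) atTop (𝓝 0) := by
  obtain ⟨_, ⟨θ', hθ', rfl⟩, hlt⟩ := lt_sSup_iff.1 h
  have hlt : θ < θ' := EReal.coe_lt_coe_iff.1 hlt
  exact tendsto_of_tendsto_of_tendsto_of_le_of_le tendsto_const_nhds hθ' (fun _ => zero_le)
    fun n => measure_mono fun ω (hω : _ < _) => lt_trans hω hlt

lemma tendsto_of_pLimsup_lt {Ω : ℕ → Type*} [∀ n, MeasurableSpace (Ω n)]
    {μ : ∀ n, Measure (Ω n)} {f : ∀ n, Ω n → ℝ} {θ : ℝ} (h : pLimsup μ f < (θ : EReal)) :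
    Tendsto (fun n => μ n {ω | θ < f n ω}) atTop (𝓝 0) := by
  obtain ⟨_, ⟨θ', hθ', rfl⟩, hlt⟩ := sInf_lt_iff.1 h
  have hlt : θ' < θ := EReal.coe_lt_coe_iff.1 hlt
  exact tendsto_of_tendsto_of_tendsto_of_le_of_le tendsto_const_nhds hθ' (fun _ => zero_le)
    fun n => measure_mono fun ω (hω : _ < _) => lt_trans hlt hω

variable {Ω : ℕ → Type*} [∀ n, MeasurableSpace (Ω n)]
  {α β : ℕ → Type*} [∀ n, MeasurableSpace (α n)] [∀ n, StandardBorelSpace (α n)]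
  [∀ n, Nonempty (α n)] [∀ n, MeasurableSpace (β n)]
  (μ : ∀ n, Measure (Ω n)) [∀ n, IsFiniteMeasure (μ n)]
  (U : ∀ n, Ω n → α n) (V : ∀ n, Ω n → β n) {n : ℕ} {ω : Ω n} {θ : ℝ}

lemma condInfo_nonneg : 0 ≤ condInfo μ U V n ω := by
  refine mul_nonneg (by positivity) ?_
  rcases (measureReal_nonneg :
    0 ≤ (condDistrib (U n) (V n) (μ n) (V n ω)).real {U n ω}).eq_or_lt with h0 | hpos
  · simp [← h0]
  · exact Real.logb_nonneg one_lt_two ((one_le_div hpos).2 measureReal_le_one)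

variable {μ U V}

lemma lt_condInfo_iff (hn : n ≠ 0)
    (h0 : condDistrib (U n) (V n) (μ n) (V n ω) {U n ω} ≠ 0) :
    θ < condInfo μ U V n ω ↔
      condDistrib (U n) (V n) (μ n) (V n ω) {U n ω} < ENNReal.ofReal (2 ^ (-(n * θ))) := by
  have hn' : (0 : ℝ) < n := by positivity
  have hpos : 0 < (condDistrib (U n) (V n) (μ n) (V n ω)).real {U n ω} :=
    ENNReal.toReal_pos h0 (measure_ne_top _ _)
  rw [ENNReal.lt_ofReal_iff_toReal_lt (measure_ne_top _ _), ← measureReal_def, condInfo,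
    one_div_mul_eq_div, lt_div_iff₀ hn', one_div, Real.logb_inv, lt_neg, mul_comm,
    Real.logb_lt_iff_lt_rpow one_lt_two hpos]

lemma measure_lt_of_lt_condInfo (hn : n ≠ 0) (h : θ < condInfo μ U V n ω) :
    condDistrib (U n) (V n) (μ n) (V n ω) {U n ω} < ENNReal.ofReal (2 ^ (-(n * θ))) := by
  by_cases h0 : condDistrib (U n) (V n) (μ n) (V n ω) {U n ω} = 0
  · rw [h0]
    positivity
  · exact (lt_condInfo_iff hn h0).1 h

lemma condInfo_lt_of_lt_measure (hn : n ≠ 0)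
    (h : ENNReal.ofReal (2 ^ (-(n * θ))) < condDistrib (U n) (V n) (μ n) (V n ω) {U n ω}) :
    condInfo μ U V n ω < θ := by
  have hn' : (0 : ℝ) < n := by positivity
  have hpos : 0 < (condDistrib (U n) (V n) (μ n) (V n ω)).real {U n ω} :=
    ENNReal.toReal_pos (zero_le.trans_lt h).ne' (measure_ne_top _ _)
  rwa [ENNReal.ofReal_lt_iff_lt_toReal (by positivity) (measure_ne_top _ _), ← measureReal_def,
    ← Real.lt_logb_iff_rpow_lt one_lt_two hpos, neg_lt, ← Real.logb_inv, ← one_div, mul_comm,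
    ← div_lt_iff₀ hn', ← one_div_mul_eq_div] at h

variable (μ U V)

lemma supEntropy_nonneg [∀ n, IsProbabilityMeasure (μ n)] : 0 ≤ supEntropy μ U V := by
  by_contra! hlt
  obtain ⟨θ, hθ, hθ0⟩ := EReal.lt_iff_exists_real_btwn.1 hlt
  have huniv : ∀ n, {ω | θ < condInfo μ U V n ω} = Set.univ := fun n =>
    Set.eq_univ_of_forall fun ω => (EReal.coe_lt_coe_iff.1 hθ0).trans_le (condInfo_nonneg μ U V)
  have hlim := tendsto_of_pLimsup_lt hθ
  simp only [huniv, measure_univ] at hlim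
  exact one_ne_zero (tendsto_nhds_unique tendsto_const_nhds hlim)

end Spectrum

section CondDistrib

variable {Ω α β : Type*} [MeasurableSpace Ω] [MeasurableSpace α] [StandardBorelSpace α]
  [Nonempty α] [Countable α] [MeasurableSpace β] {μ : Measure Ω} [IsFiniteMeasure μ] {U : Ω → α}
  {V : Ω → β}

lemma measurable_condDistrib_singleton :
    Measurable fun q : β × α => condDistrib U V μ q.1 {q.2} :=
  measurable_from_prod_countable_left fun u =>
    Kernel.measurable_coe _ (measurableSet_singleton u)

lemma lintegral_eq_lintegral_tsum_condDistrib (hU : Measurable U) (hV : Measurable V)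
    {f : β × α → ENNReal} (hf : Measurable f) :
    ∫⁻ ω, f (V ω, U ω) ∂μ = ∫⁻ v, ∑' u, f (v, u) * condDistrib U V μ v {u} ∂(μ.map V) := by
  rw [← lintegral_map (f := f) (g := fun ω => (V ω, U ω)) hf (by fun_prop),
    ← compProd_map_condDistrib hU.aemeasurable, Measure.lintegral_compProd hf]
  simp only [lintegral_countable']

lemma setLIntegral_condDistrib_lt_le [IsProbabilityMeasure μ] (hU : Measurable U)
    (hV : Measurable V) {g : β × α → ENNReal} (hg : Measurable g) (hg1 : ∀ v, ∑' u, g (v, u) ≤ 1)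
    (τ : ENNReal) :
    ∫⁻ ω in {ω | condDistrib U V μ (V ω) {U ω} < τ}, g (V ω, U ω) ∂μ ≤ τ := by
  set G : Set (β × α) := {q | condDistrib U V μ q.1 {q.2} < τ}
  have hG : MeasurableSet G := measurable_condDistrib_singleton measurableSet_Iio
  have hsum : ∀ v, ∑' u, G.indicator g (v, u) * condDistrib U V μ v {u} ≤ τ := fun v =>
    calc ∑' u, G.indicator g (v, u) * condDistrib U V μ v {u}
        ≤ ∑' u, g (v, u) * τ := ENNReal.tsum_le_tsum fun u => by
          by_cases hu : (v, u) ∈ G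
          · rw [Set.indicator_of_mem hu]
            gcongr
            exact hu.le
          · simp [hu]
      _ = (∑' u, g (v, u)) * τ := ENNReal.tsum_mul_right
      _ ≤ τ := mul_le_of_le_one_left' (hg1 v)
  calc ∫⁻ ω in (fun ω => (V ω, U ω)) ⁻¹' G, g (V ω, U ω) ∂μ
      = ∫⁻ ω, G.indicator g (V ω, U ω) ∂μ := by
        rw [← lintegral_indicator (hG.preimage (hV.prodMk hU))]
        rfl
    _ = ∫⁻ v, ∑' u, G.indicator g (v, u) * condDistrib U V μ v {u} ∂(μ.map V) :=
        lintegral_eq_lintegral_tsum_condDistrib hU hV (hg.indicator hG)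
    _ ≤ ∫⁻ _, τ ∂(μ.map V) := lintegral_mono hsum
    _ = τ := by
        rw [lintegral_const, Measure.map_apply hV MeasurableSet.univ, Set.preimage_univ,
          measure_univ, mul_one]

lemma measure_condDistrib_eq_zero (hU : Measurable U) (hV : Measurable V) :
    μ {ω | condDistrib U V μ (V ω) {U ω} = 0} = 0 := by
  set G : Set (β × α) := {q | condDistrib U V μ q.1 {q.2} = 0}
  have hG : MeasurableSet G := measurable_condDistrib_singleton (measurableSet_singleton 0)
  have hzero : ∀ v u, G.indicator (1 : β × α → ENNReal) (v, u) * condDistrib U V μ v {u} = 0 :=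
    fun v u => by by_cases h : (v, u) ∈ G <;> simp_all [G]
  calc μ ((fun ω => (V ω, U ω)) ⁻¹' G)
      = ∫⁻ ω, G.indicator (1 : β × α → ENNReal) (V ω, U ω) ∂μ :=
        (lintegral_indicator_one (hG.preimage (hV.prodMk hU))).symm
    _ = 0 := by
        rw [lintegral_eq_lintegral_tsum_condDistrib hU hV (measurable_one.indicator hG)]
        simp [hzero]

end CondDistrib

section Joint

lemma sum_prod_pmf {I : Type*} [Fintype I] [DecidableEq I] {κ : I → Type*} [∀ i, Fintype (κ i)]
    (a : ∀ i, PMF (κ i)) : ∑ x : (∀ i, κ i), ∏ i, a i (x i) = 1 := by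
  rw [← Fintype.prod_sum (fun i (k : κ i) => a i k)]
  refine Finset.prod_eq_one fun i _ => ?_
  rw [← tsum_fintype (L := .unconditional _), PMF.tsum_coe]

variable {S I J : Type*} [Fintype S] [Fintype I] [DecidableEq S] [DecidableEq I]
  {X : I → Type*} {Y : ℕ → J → Type*} [∀ i, Fintype (X i)] [∀ n j, MeasurableSpace (Y n j)]
  {A : Finset (S × I)}

namespace AuxSources

variable (Z : AuxSources A X) (W : Channel X Y) (n : ℕ)

/-- The conditional law `μ_{Y_J|Z_S}` of the channel outputs given the sources. -/
def output (z : ∀ s, Z.Alph n s) : Measure (∀ j, Y n j) :=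
  ∑ x : (∀ i, Fin n → X i), (∏ i, Z.input n i ((messagesAt A i).restrict z) (x i)) •
    (W n x : Measure (∀ j, Y n j))

instance (z : ∀ s, Z.Alph n s) : IsProbabilityMeasure (Z.output W n z) := by
  constructor
  simp only [output, Measure.finsetSum_apply, Measure.smul_apply, measure_univ, smul_eq_mul,
    mul_one]
  exact sum_prod_pmf _

lemma lintegral_output (z : ∀ s, Z.Alph n s) (f : (∀ j, Y n j) → ENNReal) :
    ∫⁻ y, f y ∂Z.output W n z = ∑ x : (∀ i, Fin n → X i),
      (∏ i, Z.input n i ((messagesAt A i).restrict z) (x i)) * ∫⁻ y, f y ∂(W n x : Measure _) := by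
  rw [output, lintegral_finsetSum_measure]
  exact Finset.sum_congr rfl fun x _ => by rw [lintegral_smul_measure, smul_eq_mul]

lemma lintegral_joint {f : (∀ s, Z.Alph n s) × (∀ j, Y n j) → ENNReal} (hf : Measurable f) :
    ∫⁻ ω, f ω ∂Z.joint W n = ∑' z, Z.law n z * ∫⁻ y, f (z, y) ∂Z.output W n z := by
  rw [joint, lintegral_sum_measure]
  refine tsum_congr fun z => ?_
  rw [lintegral_sum_measure, tsum_fintype, Z.lintegral_output, Finset.mul_sum]
  refine Finset.sum_congr rfl fun x _ => ?_
  rw [lintegral_smul_measure, Measure.dirac_prod, lintegral_map hf measurable_prodMk_left,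
    smul_eq_mul, mul_assoc]

lemma joint_apply {B : Set ((∀ s, Z.Alph n s) × (∀ j, Y n j))} (hB : MeasurableSet B) :
    Z.joint W n B = ∑' z, Z.law n z * Z.output W n z {y | (z, y) ∈ B} := by
  rw [← lintegral_indicator_one hB, Z.lintegral_joint W n (measurable_one.indicator hB)]
  refine tsum_congr fun z => ?_
  rw [← lintegral_indicator_one
    (show MeasurableSet {y | (z, y) ∈ B} from measurable_prodMk_left hB)]
  rfl

lemma map_fst_joint : (Z.joint W n).map Prod.fst = (Z.law n).toMeasure := by
  refine Measure.ext_of_singleton fun z => ?_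
  rw [Measure.map_apply measurable_fst (measurableSet_singleton z),
    Z.joint_apply W n (measurable_fst (measurableSet_singleton z)),
    PMF.toMeasure_apply_singleton _ _ (measurableSet_singleton z), tsum_eq_single z]
  · simp
  · intro z' hz'
    simp [hz']

lemma map_restrict_joint_singleton (T : Finset S) (z : ∀ s, Z.Alph n s) :
    (Z.joint W n).map (fun ω => T.restrict ω.1) {T.restrict z} = marg (Z.law n) T z := by
  rw [show (fun ω : (∀ s, Z.Alph n s) × (∀ j, Y n j) => T.restrict ω.1) = T.restrict ∘ Prod.fst
    from rfl, ← Measure.map_map (by fun_prop) measurable_fst, Z.map_fst_joint W n,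
    PMF.toMeasure_map _ _ (by fun_prop),
    PMF.toMeasure_apply_singleton _ _ (measurableSet_singleton _), marg]

lemma condDistrib_restrict (T U : Finset S) (z : ∀ s, Z.Alph n s)
    (hz : marg (Z.law n) U z ≠ 0) :
    condDistrib (fun ω => T.restrict ω.1) (fun ω => U.restrict ω.1) (Z.joint W n)
      (U.restrict z) {T.restrict z} = marg (Z.law n) (T ∪ U) z / marg (Z.law n) U z := by
  have hm : ∀ T : Finset S, Measurable
      fun ω : (∀ s, Z.Alph n s) × (∀ j, Y n j) => T.restrict ω.1 := fun T => by fun_prop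
  rw [condDistrib_apply_of_ne_zero (hm T) _ (by rwa [map_restrict_joint_singleton]),
    map_restrict_joint_singleton, ENNReal.div_eq_inv_mul,
    ← Z.map_restrict_joint_singleton W n (T ∪ U),
    Measure.map_apply ((hm U).prodMk (hm T))
      ((measurableSet_singleton _).prod (measurableSet_singleton _)),
    Measure.map_apply (hm _) (measurableSet_singleton _)]
  congr 2
  refine Set.ext fun ω => ?_
  simp only [Set.mem_preimage, Set.mem_prod, Set.mem_singleton_iff, funext_iff,
    Finset.restrict, Subtype.forall, Finset.mem_union]
  grind

end AuxSources

end Joint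

/-! ### The converse -/

section Uniform

variable {S : Type*} {κ : S → Type*} [∀ s, Fintype (κ s)]

lemma prod_inv_card_ne_zero (T : Finset S) : ∏ s ∈ T, (Fintype.card (κ s) : ENNReal)⁻¹ ≠ 0 :=
  Finset.prod_ne_zero_iff.2 fun _ _ => ENNReal.inv_ne_zero.2 (ENNReal.natCast_ne_top _)

variable [∀ s, Nonempty (κ s)]

lemma prod_inv_card_ne_top (T : Finset S) : ∏ s ∈ T, (Fintype.card (κ s) : ENNReal)⁻¹ ≠ ⊤ :=
  ENNReal.prod_ne_top fun _ _ => ENNReal.inv_ne_top.2 (Nat.cast_ne_zero.2 Fintype.card_ne_zero)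

variable [Fintype S] [DecidableEq S]

lemma uniformOfFintype_pi_apply (k : ∀ s, κ s) :
    PMF.uniformOfFintype (∀ s, κ s) k = ∏ s, (Fintype.card (κ s) : ENNReal)⁻¹ := by
  rw [PMF.uniformOfFintype_apply, Fintype.card_pi, Nat.cast_prod, ENNReal.prod_inv_distrib]
  exact fun s _ t _ _ => .inr (ENNReal.natCast_ne_top _)

lemma marg_uniformOfFintype (T : Finset S) (k : ∀ s, κ s) :
    marg (PMF.uniformOfFintype (∀ s, κ s)) T k = ∏ s ∈ T, (Fintype.card (κ s) : ENNReal)⁻¹ := by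
  classical
  have hterm : ∀ k' : (∀ s, κ s), (if T.restrict k = T.restrict k' then
      PMF.uniformOfFintype (∀ s, κ s) k' else 0) =
        ∏ s, if s ∈ T → k s = k' s then (Fintype.card (κ s) : ENNReal)⁻¹ else 0 := fun k' => by
    rw [uniformOfFintype_pi_apply]
    by_cases h : ∀ s ∈ T, k s = k' s
    · have hres : T.restrict k = T.restrict k' := funext fun s => h s s.2
      rw [if_pos hres]
      exact Finset.prod_congr rfl fun s _ => (if_pos (h s)).symm
    · have hres : T.restrict k ≠ T.restrict k' := fun h' => h fun s hs => congrFun h' ⟨s, hs⟩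
      rw [if_neg hres]
      push Not at h
      obtain ⟨s, hs, hne⟩ := h
      exact (Finset.prod_eq_zero (Finset.mem_univ s) (if_neg fun h => hne (h hs))).symm
  have hfactor : ∀ s, (∑ a : κ s, if s ∈ T → k s = a then (Fintype.card (κ s) : ENNReal)⁻¹ else 0) =
      if s ∈ T then (Fintype.card (κ s) : ENNReal)⁻¹ else 1 := fun s => by
    by_cases hs : s ∈ T
    · simp [hs]
    · simp [hs, ENNReal.mul_inv_cancel (Nat.cast_ne_zero.2 Fintype.card_ne_zero)]
  calc marg (PMF.uniformOfFintype (∀ s, κ s)) T k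
      = ∑ k' : (∀ s, κ s), ∏ s,
          if s ∈ T → k s = k' s then (Fintype.card (κ s) : ENNReal)⁻¹ else 0 :=
        (PMF.map_apply _ _ _).trans ((tsum_fintype _).trans
          (Finset.sum_congr rfl fun k' _ => by rw [← hterm k']; congr))
    _ = ∏ s, ∑ a : κ s, if s ∈ T → k s = a then (Fintype.card (κ s) : ENNReal)⁻¹ else 0 :=
        (Fintype.prod_sum fun s a =>
          if s ∈ T → k s = a then (Fintype.card (κ s) : ENNReal)⁻¹ else 0).symm
    _ = ∏ s ∈ T, (Fintype.card (κ s) : ENNReal)⁻¹ := by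
        simp only [hfactor, Finset.prod_ite_mem, Finset.univ_inter]

lemma marg_uniformOfFintype_union_div {P U : Finset S} (h : Disjoint P U) (k : ∀ s, κ s) :
    marg (PMF.uniformOfFintype (∀ s, κ s)) (P ∪ U) k /
      marg (PMF.uniformOfFintype (∀ s, κ s)) U k = ∏ s ∈ P, (Fintype.card (κ s) : ENNReal)⁻¹ := by
  rw [marg_uniformOfFintype, marg_uniformOfFintype, Finset.prod_union h]
  exact ENNReal.mul_div_cancel_right (prod_inv_card_ne_zero U) (prod_inv_card_ne_top U)

end Uniform

section Converse

variable {S I J : Type*} [Fintype S] [DecidableEq S] [DecidableEq I] {X : I → Type*}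
  {Y : ℕ → J → Type*} [∀ n j, MeasurableSpace (Y n j)] {A : Finset (S × I)} {D : J → Finset S}

instance Code.nonempty_fin_size {n : ℕ} (C : Code A D X Y n) (s : S) : Nonempty (Fin (C.size s)) :=
  ⟨⟨0, C.size_pos s⟩⟩

lemma Code.measurable_dec_apply {n : ℕ} (C : Code A D X Y n) (j : J) {V : Type*} [Countable V]
    [MeasurableSpace V] [MeasurableSingletonClass V] (B : V → Set (∀ s : D j, Fin (C.size s))) :
    Measurable fun q : V × Y n j => C.dec j q.2 (B q.1) :=
  measurable_from_prod_countable_right fun v =>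
    Kernel.measurable_coe _ (Set.toFinite (B v)).measurableSet

variable [Fintype I]

/-- The auxiliary sources of the converse: the messages of a sequence of codes themselves. -/
def Code.toAuxSources (C : ∀ n, Code A D X Y n) : AuxSources A X where
  Alph n s := Fin ((C n).size s)
  countable _ _ := inferInstance
  nonempty _ _ := inferInstance
  law n := PMF.uniformOfFintype (∀ s, Fin ((C n).size s))
  factorizes n z :=
    calc PMF.uniformOfFintype (∀ s, Fin ((C n).size s)) z
        = ∏ s, (Fintype.card (Fin ((C n).size s)) : ENNReal)⁻¹ := uniformOfFintype_pi_apply z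
      _ = ∏ I' ∈ accessFamily A, ∏ s ∈ privateMessages A I',
            (Fintype.card (Fin ((C n).size s)) : ENNReal)⁻¹ := (prod_accessFamily A _).symm
      _ = _ := Finset.prod_congr rfl fun I' _ =>
          (marg_uniformOfFintype_union_div (disjoint_privateMessages_publicMessages A I') z).symm
  input n i := (C n).enc i

variable [∀ i, Fintype (X i)] (C : ∀ n, Code A D X Y n) (W : Channel X Y) (n : ℕ)

lemma condInfo_toAuxSources {T U : Finset S} (hTU : Disjoint T U)
    (ω : (∀ s, (Code.toAuxSources C).Alph n s) × (∀ j, Y n j)) :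
    condInfo ((Code.toAuxSources C).joint W) (fun _ ω => T.restrict ω.1)
      (fun _ ω => U.restrict ω.1) n ω = ∑ s ∈ T, Real.logb 2 ((C n).size s) / n := by
  have hU : marg ((Code.toAuxSources C).law n) U ω.1 ≠ 0 :=
    (marg_uniformOfFintype (κ := fun s => Fin ((C n).size s)) U ω.1).trans_ne
      (prod_inv_card_ne_zero U)
  have hcond := ((Code.toAuxSources C).condDistrib_restrict W n T U ω.1 hU).trans
    (marg_uniformOfFintype_union_div (κ := fun s => Fin ((C n).size s)) hTU ω.1)
  simp only [condInfo, measureReal_def, hcond, Fintype.card_fin, ENNReal.toReal_prod,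
    ENNReal.toReal_inv, ENNReal.toReal_natCast, Finset.prod_inv_distrib, one_div, inv_inv]
  rw [Real.logb_prod _ _ fun s _ => Nat.cast_ne_zero.2 ((C n).size_pos s).ne', Finset.mul_sum]
  simp only [div_eq_inv_mul]

lemma le_infEntropy_toAuxSources {R : S → ℝ}
    (hR : ∀ s, (R s : EReal) ≤
      liminf (fun n : ℕ => ((Real.logb 2 ((C n).size s) / (n : ℝ) : ℝ) : EReal)) atTop)
    {T U : Finset S} (hTU : Disjoint T U) (hT : T.Nonempty) :
    ((∑ s ∈ T, R s : ℝ) : EReal) ≤ infEntropy ((Code.toAuxSources C).joint W)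
      (fun _ ω => T.restrict ω.1) (fun _ ω => U.restrict ω.1) := by
  refine EReal.ge_of_forall_gt_iff_ge.1 fun θ hθ => le_sSup ⟨θ, ?_, rfl⟩
  have hθ : 0 < ∑ s ∈ T, R s - θ := sub_pos.2 (EReal.coe_lt_coe_iff.1 hθ)
  have hcard : (0 : ℝ) < T.card := Nat.cast_pos.2 hT.card_pos
  refine tendsto_const_nhds.congr' ?_
  filter_upwards [eventually_forall_sub_lt_of_le_liminf hR (div_pos hθ hcard)] with n hn
  refine (measure_mono_null (fun ω (hω : _ < θ) => ?_) measure_empty).symm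
  have hsum : ∑ s ∈ T, (R s - (∑ s ∈ T, R s - θ) / T.card) ≤
      ∑ s ∈ T, Real.logb 2 ((C n).size s) / (n : ℝ) := Finset.sum_le_sum fun s _ => (hn s).le
  rw [condInfo_toAuxSources C W n hTU] at hω
  rw [Finset.sum_sub_distrib, Finset.sum_const, nsmul_eq_mul, mul_div_cancel₀ _ hcard.ne'] at hsum
  exact absurd hω (by linarith)

variable [Fintype J]

lemma lintegral_dec_le_errorProb (j : J) :
    ∫⁻ ω, (C n).dec j (ω.2 j) {m | ∃ s : D j, m s ≠ ω.1 s} ∂(Code.toAuxSources C).joint W n ≤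
      (C n).errorProb W := by
  have := fun j => (C n).dec_markov j
  have hmeas : Measurable fun ω : (∀ s, (Code.toAuxSources C).Alph n s) × (∀ j, Y n j) =>
      (C n).dec j (ω.2 j) {m | ∃ s : D j, m s ≠ ω.1 s} :=
    ((C n).measurable_dec_apply j fun z : (∀ s, (Code.toAuxSources C).Alph n s) =>
      {m | ∃ s : D j, m s ≠ z s}).comp
        (measurable_fst.prodMk ((measurable_pi_apply j).comp measurable_snd))
  have hdec : ∀ (z : ∀ s, Fin ((C n).size s)) (y : ∀ j, Y n j),
      (C n).dec j (y j) {m | ∃ s : D j, m s ≠ z s} ≤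
        Measure.pi (fun j => (C n).dec j (y j)) {m | ∃ j, ∃ s : D j, m j s ≠ z s} := fun z y => by
    rw [← (measurePreserving_eval (fun j => (C n).dec j (y j)) j).measure_preimage
      (Set.toFinite _).measurableSet.nullMeasurableSet]
    exact measure_mono fun m ⟨s, hs⟩ => ⟨j, s, hs⟩
  rw [AuxSources.lintegral_joint _ _ _ hmeas, Code.errorProb]
  change (∑' z : (∀ s, Fin ((C n).size s)), PMF.uniformOfFintype _ z * _) ≤ _
  rw [tsum_fintype]
  refine Finset.sum_le_sum fun z _ => mul_le_mul ?_ ?_ zero_le zero_le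
  · refine (uniformOfFintype_pi_apply z).trans_le ?_
    simp only [Fintype.card_fin, le_refl]
  · refine ((Code.toAuxSources C).lintegral_output W n z _).trans_le ?_
    exact Finset.sum_le_sum fun x _ => mul_le_mul le_rfl (lintegral_mono (hdec z)) zero_le zero_le

lemma joint_condDistrib_lt_le (j : J) {D' : Finset S} (hD' : D' ⊆ D j) (τ : ENNReal) :
    (Code.toAuxSources C).joint W n {ω | condDistrib (fun ω => D'.restrict ω.1)
      (fun ω => (ω.2 j, (D j \ D').restrict ω.1)) ((Code.toAuxSources C).joint W n)
      (ω.2 j, (D j \ D').restrict ω.1) {D'.restrict ω.1} < τ} ≤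
      (C n).errorProb W + τ := by
  have hMarkov := (C n).dec_markov j
  set μ := (Code.toAuxSources C).joint W n
  set G : Set ((∀ s, (Code.toAuxSources C).Alph n s) × (∀ j, Y n j)) :=
    {ω | condDistrib (fun ω => D'.restrict ω.1) (fun ω => (ω.2 j, (D j \ D').restrict ω.1)) μ
      (ω.2 j, (D j \ D').restrict ω.1) {D'.restrict ω.1} < τ}
  let g : (Y n j × (∀ s : ↥(D j \ D'), (Code.toAuxSources C).Alph n s)) ×
      (∀ s : D', (Code.toAuxSources C).Alph n s) → ENNReal :=
    fun q => (C n).dec j q.1.1 {m | ∀ s : D', m ⟨s, hD' s.2⟩ = q.2 s}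
  have hg : Measurable g :=
    ((C n).measurable_dec_apply j fun u : (∀ s : D', (Code.toAuxSources C).Alph n s) =>
      {m | ∀ s : D', m ⟨s, hD' s.2⟩ = u s}).comp
        (measurable_snd.prodMk (measurable_fst.comp measurable_fst))
  have hg1 : ∀ v, ∑' u, g (v, u) ≤ 1 := fun v => by
    refine (measure_iUnion (μ := (C n).dec j v.1) (fun u u' huu' => ?_)
      fun u => (Set.toFinite _).measurableSet).symm.trans_le prob_le_one
    exact Set.disjoint_left.2 fun m hm hm' => huu' (funext fun s => (hm s).symm.trans (hm' s))
  have hcover : ∀ ω : (∀ s, (Code.toAuxSources C).Alph n s) × (∀ j, Y n j),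
      1 ≤ (C n).dec j (ω.2 j) {m | ∃ s : D j, m s ≠ ω.1 s} +
        g ((ω.2 j, (D j \ D').restrict ω.1), D'.restrict ω.1) := fun ω => by
    rw [← measure_univ (μ := (C n).dec j (ω.2 j))]
    refine (measure_mono fun m _ => ?_).trans (measure_union_le _ _)
    by_cases hm : ∃ s : D j, m s ≠ ω.1 s
    · exact .inl hm
    · push Not at hm
      exact .inr fun s => hm ⟨s, hD' s.2⟩
  calc μ G = ∫⁻ _ in G, 1 ∂μ := (setLIntegral_one G).symm
    _ ≤ ∫⁻ ω in G, ((C n).dec j (ω.2 j) {m | ∃ s : D j, m s ≠ ω.1 s} +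
          g ((ω.2 j, (D j \ D').restrict ω.1), D'.restrict ω.1)) ∂μ := lintegral_mono hcover
    _ = ∫⁻ ω in G, (C n).dec j (ω.2 j) {m | ∃ s : D j, m s ≠ ω.1 s} ∂μ +
          ∫⁻ ω in G, g ((ω.2 j, (D j \ D').restrict ω.1), D'.restrict ω.1) ∂μ :=
        lintegral_add_right _ (hg.comp (by fun_prop))
    _ ≤ (C n).errorProb W + τ := add_le_add
        ((setLIntegral_le_lintegral _ _).trans (lintegral_dec_le_errorProb C W n j))
        (setLIntegral_condDistrib_lt_le (by fun_prop) (by fun_prop) hg hg1 τ)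

lemma tendsto_ofReal_two_rpow_neg {θ : ℝ} (hθ : 0 < θ) :
    Tendsto (fun n : ℕ => ENNReal.ofReal (2 ^ (-(n * θ)))) atTop (𝓝 0) := by
  have hgeom : (fun n : ℕ => (2 : ℝ) ^ (-(n * θ))) = fun n : ℕ => ((2 : ℝ) ^ (-θ)) ^ n := by
    funext n
    rw [← Real.rpow_mul_natCast two_pos.le]
    ring_nf
  rw [← ENNReal.ofReal_zero]
  refine ENNReal.tendsto_ofReal ?_
  rw [hgeom]
  exact tendsto_pow_atTop_nhds_zero_of_lt_one (by positivity)
    (Real.rpow_lt_one_of_one_lt_of_neg one_lt_two (neg_lt_zero.2 hθ))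

lemma supEntropy_toAuxSources_le_zero (herr : Tendsto (fun n => (C n).errorProb W) atTop (𝓝 0))
    (j : J) {D' : Finset S} (hD' : D' ⊆ D j) :
    supEntropy ((Code.toAuxSources C).joint W) (fun _ ω => D'.restrict ω.1)
      (fun _ ω => (ω.2 j, (D j \ D').restrict ω.1)) ≤ 0 := by
  refine EReal.le_of_forall_lt_iff_le.1 fun θ hθ => sInf_le ⟨θ, ?_, rfl⟩
  have hlim : Tendsto (fun n : ℕ => (C n).errorProb W + ENNReal.ofReal (2 ^ (-(n * θ)))) atTop
      (𝓝 0) := by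
    simpa using herr.add (tendsto_ofReal_two_rpow_neg (EReal.coe_pos.1 hθ))
  refine tendsto_of_tendsto_of_tendsto_of_le_of_le' tendsto_const_nhds hlim
    (Eventually.of_forall fun _ => zero_le) ?_
  filter_upwards [eventually_ne_atTop 0] with n hn
  refine (measure_mono fun ω hω => ?_).trans (joint_condDistrib_lt_le C W n j hD' _)
  exact measure_lt_of_lt_condInfo (μ := (Code.toAuxSources C).joint W)
    (U := fun _ ω => D'.restrict ω.1)
    (V := fun _ ω => (ω.2 j, (D j \ D').restrict ω.1)) hn hω

lemma mem_RIT_of_isAchievable {W : Channel X Y} {R : S → ℝ} (h : IsAchievable A D W R) :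
    R ∈ RIT A D W := by
  obtain ⟨hR0, C, hR, herr⟩ := h
  refine ⟨hR0, Code.toAuxSources C, 0, fun I' _ S' hS' hne => ?_, fun j D' hD' _ => ?_⟩
  · simpa using le_infEntropy_toAuxSources C W hR
      (Finset.disjoint_of_subset_left hS' (disjoint_privateMessages_publicMessages A I')) hne
  · simpa using supEntropy_toAuxSources_le_zero C W herr j hD'

end Converse

/-! ### Nearly uniform bin numbers -/

-- The excess of `2 / η` on the left is `(r⁻¹ + r) / η` at its minimum `r = 1`; both `r⁻¹` and `r`
-- have mean about `1` below, so that the terms of order `1 / η` nearly cancel.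
lemma one_sub_min_add_le {r η : ℝ} (hr : 0 < r) (hη : 0 < η) :
    1 - min 1 r + 2 / η ≤ η + (r⁻¹ + r) / η := by
  have hsq : (1 - min 1 r) ^ 2 ≤ r⁻¹ + r - 2 := by
    have hsub : r⁻¹ + r - 2 = (1 - r) ^ 2 * r⁻¹ := by field_simp; ring
    rw [hsub]
    rcases le_total 1 r with h | h
    · rw [min_eq_left h, sub_self, zero_pow two_ne_zero]
      positivity
    · rw [min_eq_right h]
      exact le_mul_of_one_le_right (sq_nonneg _) ((one_le_inv₀ hr).2 h)
  rw [← sub_nonneg]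
  have hdiff : η + (r⁻¹ + r) / η - (1 - min 1 r + 2 / η) =
      (η * η + (r⁻¹ + r - 2) - (1 - min 1 r) * η) / η := by field_simp; ring
  rw [hdiff]
  exact div_nonneg (by nlinarith [sq_nonneg (1 - min 1 r - η)]) hη.le

lemma ennreal_one_sub_min_add_le {r : ENNReal} (hr₀ : r ≠ 0) (hr : r ≠ ⊤) {η : ℝ} (hη : 0 < η) :
    1 - min 1 r + 2 / ENNReal.ofReal η ≤
      ENNReal.ofReal η + (r⁻¹ + r) / ENNReal.ofReal η := by
  lift r to NNReal using hr
  lift η to NNReal using hη.le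
  have hr' : r ≠ 0 := ENNReal.coe_ne_zero.1 hr₀
  have hη' : η ≠ 0 := (NNReal.coe_pos.1 hη).ne'
  have h : 1 - min 1 r + 2 / η ≤ η + (r⁻¹ + r) / η := by
    rw [← NNReal.coe_le_coe]
    push_cast [NNReal.coe_sub (min_le_left 1 r)]
    exact one_sub_min_add_le (NNReal.coe_pos.2 (pos_iff_ne_zero.2 hr')) hη
  rw [ENNReal.ofReal_coe_nnreal]
  simpa only [ENNReal.coe_add, ENNReal.coe_sub, ENNReal.coe_div hη', ENNReal.coe_inv hr',
    ENNReal.coe_min, ENNReal.coe_one, ENNReal.coe_ofNat] using ENNReal.coe_le_coe.2 h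

section RandomBinning

variable {S : Type*} {Alph κ : S → Type*} (p : PMF (∀ s, Alph s)) (b : ∀ s, Alph s → κ s)
  (P U : Finset S) (z : ∀ s, Alph s)

/-- What a block of encoders sees of the source vector `z`: the public components `U`
themselves, and the bin numbers of the private components `P` under the binning `b`. -/
def blockHash : (∀ s : U, Alph s) × (∀ s : P, κ s) :=
  (U.restrict z, P.restrict (Pi.map b z))

variable [∀ s, Fintype (κ s)]

/-- The density, at the block hash of `z`, of the ideal law (public components as under `p`,
independent uniform bins) with respect to the law of the block hash under `p`. -/
def binDensity : ENNReal :=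
  marg p U z * (∏ s ∈ P, (Fintype.card (κ s) : ENNReal)⁻¹) /
    p.map (blockHash b P U) (blockHash b P U z)

variable {p z} in
lemma inv_binDensity (hz : p z ≠ 0) :
    (binDensity p b P U z)⁻¹ = p.map (blockHash b P U) (blockHash b P U z) *
      (∏ s ∈ P, (Fintype.card (κ s) : ENNReal)) / marg p U z := by
  have hmass : p.map (blockHash b P U) (blockHash b P U z) ≠ 0 :=
    (pos_iff_ne_zero.2 hz |>.trans_le (apply_le_map_apply p _ z)).ne'
  have hprod : ∏ s ∈ P, (Fintype.card (κ s) : ENNReal)⁻¹ =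
      (∏ s ∈ P, (Fintype.card (κ s) : ENNReal))⁻¹ :=
    (ENNReal.prod_inv_distrib fun s _ t _ _ => .inr (ENNReal.natCast_ne_top _)).symm
  rw [binDensity, ENNReal.inv_div (.inl (PMF.apply_ne_top _ _)) (.inl hmass), hprod,
    ENNReal.div_eq_inv_mul, ENNReal.mul_inv (.inl (marg_ne_zero U hz))
      (.inl (marg_ne_top p U z)), inv_inv, ENNReal.div_eq_inv_mul]
  ring

variable {p z} in
lemma binDensity_ne_zero (hz : p z ≠ 0) : binDensity p b P U z ≠ 0 :=
  ENNReal.div_ne_zero.2 ⟨mul_ne_zero (marg_ne_zero U hz) (prod_inv_card_ne_zero P),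
    PMF.apply_ne_top _ _⟩

variable [∀ s, Nonempty (κ s)]

variable {p z} in
lemma binDensity_ne_top (hz : p z ≠ 0) : binDensity p b P U z ≠ ⊤ :=
  ENNReal.div_ne_top (ENNReal.mul_ne_top (PMF.apply_ne_top _ _) (prod_inv_card_ne_top P))
    (pos_iff_ne_zero.2 hz |>.trans_le (apply_le_map_apply p _ z)).ne'

lemma tsum_mul_binDensity_le_one : ∑' z, p z * binDensity p b P U z ≤ 1 := by
  classical
  have huniform : ∀ v : (∀ s : P, κ s),
      ∏ s ∈ P, (Fintype.card (κ s) : ENNReal)⁻¹ = PMF.uniformOfFintype (∀ s : P, κ s) v :=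
    fun v => (Finset.prod_coe_sort P _).symm.trans (uniformOfFintype_pi_apply v).symm
  calc ∑' z, p z * binDensity p b P U z
      = ∑' y, p.map (blockHash b P U) y * (p.map U.restrict y.1 *
          (∏ s ∈ P, (Fintype.card (κ s) : ENNReal)⁻¹) / p.map (blockHash b P U) y) :=
        (tsum_map_mul p (blockHash b P U) fun y => p.map U.restrict y.1 *
          (∏ s ∈ P, (Fintype.card (κ s) : ENNReal)⁻¹) / p.map (blockHash b P U) y).symm
    _ ≤ ∑' y : (∀ s : U, Alph s) × (∀ s : P, κ s),
          p.map U.restrict y.1 * PMF.uniformOfFintype (∀ s : P, κ s) y.2 :=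
        ENNReal.tsum_le_tsum fun y => by
          rw [← huniform y.2]
          exact ENNReal.mul_div_le
    _ = 1 := by
        rw [ENNReal.tsum_prod']
        simp only [ENNReal.tsum_mul_left, PMF.tsum_coe, mul_one]

lemma tsum_one_sub_min_binDensity_add_le (T : Set (∀ s, Alph s)) {η : ℝ}
    (hη : 0 < η) :
    ∑' z, p z * (1 - min 1 (binDensity p b P U z)) +
        p.toOuterMeasure T * (2 / ENNReal.ofReal η) ≤
      p.toOuterMeasure Tᶜ + ENNReal.ofReal η +
        (∑' z, T.indicator (fun z => p z * (binDensity p b P U z)⁻¹) z + 1) /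
          ENNReal.ofReal η := by
  have hpoint : ∀ z, p z * (1 - min 1 (binDensity p b P U z)) +
      T.indicator p z * (2 / ENNReal.ofReal η) ≤
      Tᶜ.indicator p z + p z * ENNReal.ofReal η +
        (T.indicator (fun z => p z * (binDensity p b P U z)⁻¹) z +
          p z * binDensity p b P U z) / ENNReal.ofReal η := fun z => by
    rcases eq_or_ne (p z) 0 with hz | hz
    · by_cases hT : z ∈ T <;> simp [hT, hz]
    by_cases hT : z ∈ T
    · simp only [Set.indicator_of_mem hT, Set.indicator_of_notMem (Set.notMem_compl_iff.2 hT),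
        zero_add, ← mul_add, mul_div_assoc]
      exact mul_le_mul_right (ennreal_one_sub_min_add_le (binDensity_ne_zero b P U hz)
        (binDensity_ne_top b P U hz) hη) _
    · simp only [Set.indicator_of_notMem hT, Set.indicator_of_mem (Set.mem_compl hT), zero_mul,
        add_zero, add_assoc]
      exact (mul_le_of_le_one_right' tsub_le_self).trans le_self_add
  calc _ = ∑' z, (p z * (1 - min 1 (binDensity p b P U z)) +
        T.indicator p z * (2 / ENNReal.ofReal η)) := by
        rw [ENNReal.tsum_add, ENNReal.tsum_mul_right, PMF.toOuterMeasure_apply]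
    _ ≤ _ := ENNReal.tsum_le_tsum hpoint
    _ = p.toOuterMeasure Tᶜ + ENNReal.ofReal η +
        (∑' z, T.indicator (fun z => p z * (binDensity p b P U z)⁻¹) z +
          ∑' z, p z * binDensity p b P U z) / ENNReal.ofReal η := by
        simp only [div_eq_mul_inv, ENNReal.tsum_add, ENNReal.tsum_mul_right,
          PMF.toOuterMeasure_apply, PMF.tsum_coe, one_mul]
    _ ≤ _ := by
        gcongr
        exact tsum_mul_binDensity_le_one p b P U

lemma lintegral_one_sub_min_binDensity_add_le [∀ s, MeasurableSpace (κ s)]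
    (ρ : Measure (∀ s, Alph s → κ s)) [IsProbabilityMeasure ρ] (T : Set (∀ s, Alph s)) {η : ℝ}
    (hη : 0 < η) :
    ∫⁻ b, ∑' z, p z * (1 - min 1 (binDensity p b P U z)) ∂ρ +
        p.toOuterMeasure T * (2 / ENNReal.ofReal η) ≤
      p.toOuterMeasure Tᶜ + ENNReal.ofReal η +
        (∫⁻ b, ∑' z, T.indicator (fun z => p z * (binDensity p b P U z)⁻¹) z ∂ρ + 1) /
          ENNReal.ofReal η :=
  calc ∫⁻ b, ∑' z, p z * (1 - min 1 (binDensity p b P U z)) ∂ρ +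
        p.toOuterMeasure T * (2 / ENNReal.ofReal η)
      = ∫⁻ b, (∑' z, p z * (1 - min 1 (binDensity p b P U z)) +
          p.toOuterMeasure T * (2 / ENNReal.ofReal η)) ∂ρ := by
        rw [lintegral_add_right _ measurable_const, lintegral_const, measure_univ, mul_one]
    _ ≤ ∫⁻ b, (p.toOuterMeasure Tᶜ + ENNReal.ofReal η +
          (∑' z, T.indicator (fun z => p z * (binDensity p b P U z)⁻¹) z + 1) /
            ENNReal.ofReal η) ∂ρ :=
        lintegral_mono fun b => tsum_one_sub_min_binDensity_add_le p b P U T hη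
    _ = _ := by
        simp only [div_eq_mul_inv]
        rw [lintegral_add_left measurable_const, lintegral_const, measure_univ, mul_one,
          lintegral_mul_const' _ _ (ENNReal.inv_ne_top.2 (ENNReal.ofReal_pos.2 hη).ne'),
          lintegral_add_right _ measurable_const, lintegral_const, measure_univ, mul_one]

end RandomBinning

section Collisions

variable {S : Type*} {Alph κ : S → Type*}

lemma map_blockHash_apply (p : PMF (∀ s, Alph s)) (b : ∀ s, Alph s → κ s) (P U : Finset S)
    (z : ∀ s, Alph s) :
    p.map (blockHash b P U) (blockHash b P U z) =
      ∑' z', {b | blockHash b P U z = blockHash b P U z'}.indicator (fun _ => p z') b := by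
  classical
  rw [PMF.map_apply]
  exact tsum_congr fun z' => by simp [Set.indicator_apply]

variable [∀ s, Countable (κ s)] [∀ s, MeasurableSpace (κ s)]
  [∀ s, MeasurableSingletonClass (κ s)]

lemma measurableSet_blockHash_eq (P U : Finset S) (z z' : ∀ s, Alph s) :
    MeasurableSet {b : ∀ s, Alph s → κ s | blockHash b P U z = blockHash b P U z'} := by
  have hset : {b : ∀ s, Alph s → κ s | blockHash b P U z = blockHash b P U z'} =
      {_b | U.restrict z = U.restrict z'} ∩ ⋂ s ∈ P, {b | b s (z s) = b s (z' s)} := by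
    ext b
    simp only [blockHash, Prod.mk.injEq, funext_iff (f := P.restrict _), Finset.restrict,
      Subtype.forall, Pi.map_apply, Set.mem_inter_iff, Set.mem_ofPred_eq, Set.mem_iInter]
  rw [hset]
  refine (MeasurableSet.const _).inter (Finset.measurableSet_biInter P fun s _ => ?_)
  exact measurableSet_eq_fun (by fun_prop) (by fun_prop)

variable [Finite S] [∀ s, Countable (Alph s)]

lemma lintegral_map_blockHash (p : PMF (∀ s, Alph s)) (ρ : Measure (∀ s, Alph s → κ s))
    (P U : Finset S) (z : ∀ s, Alph s) :
    ∫⁻ b, p.map (blockHash b P U) (blockHash b P U z) ∂ρ =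
      ∑' z', p z' * ρ {b | blockHash b P U z = blockHash b P U z'} := by
  simp only [map_blockHash_apply]
  rw [lintegral_tsum fun z' =>
    (measurable_const.indicator (measurableSet_blockHash_eq P U z z')).aemeasurable]
  exact tsum_congr fun z' => lintegral_indicator_const (measurableSet_blockHash_eq P U z z') _

lemma measurable_map_blockHash (p : PMF (∀ s, Alph s)) (P U : Finset S) (z : ∀ s, Alph s) :
    Measurable fun b : (∀ s, Alph s → κ s) => p.map (blockHash b P U) (blockHash b P U z) := by
  simp only [map_blockHash_apply]
  exact Measurable.tsum fun z' =>
    measurable_const.indicator (measurableSet_blockHash_eq P U z z')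

end Collisions

section Extraction

variable {S : Type*} {Alph κ : S → Type*} [∀ s, Fintype (κ s)]

lemma measurable_binDensity [Finite S] [∀ s, Countable (Alph s)] [∀ s, MeasurableSpace (κ s)]
    [∀ s, MeasurableSingletonClass (κ s)] (p : PMF (∀ s, Alph s)) (P U : Finset S)
    (z : ∀ s, Alph s) : Measurable fun b : (∀ s, Alph s → κ s) => binDensity p b P U z :=
  (measurable_map_blockHash p P U z).const_div _

/-- The source values for which all conditional probabilities of the components in `P ∩ B`,
given those in `U`, are small compared to the numbers of bins. -/
def IsSpread [DecidableEq S] (p : PMF (∀ s, Alph s)) (κ : S → Type*) [∀ s, Fintype (κ s)]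
    (P U B : Finset S) (ε : ENNReal) (z : ∀ s, Alph s) : Prop :=
  ∀ S' ⊆ P ∩ B, S'.Nonempty →
    marg p (S' ∪ U) z / marg p U z * ∏ s ∈ S', (Fintype.card (κ s) : ENNReal) ≤ ε

variable [DecidableEq S] [Fintype S]

lemma IsSpread.sum_powerset_le {p : PMF (∀ s, Alph s)} {P U B : Finset S} {ε : ENNReal}
    {z : ∀ s, Alph s} (h : IsSpread p κ P U B ε z) :
    ∑ S' ∈ (P ∩ B).powerset,
        marg p (S' ∪ U) z / marg p U z * ∏ s ∈ S', (Fintype.card (κ s) : ENNReal) ≤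
      1 + 2 ^ Fintype.card S * ε := by
  calc ∑ S' ∈ (P ∩ B).powerset,
        marg p (S' ∪ U) z / marg p U z * ∏ s ∈ S', (Fintype.card (κ s) : ENNReal)
      ≤ ∑ S' ∈ (P ∩ B).powerset, ((if S' = ∅ then 1 else 0) + ε) := by
        refine Finset.sum_le_sum fun S' hS' => ?_
        rcases S'.eq_empty_or_nonempty with rfl | hne
        · simp only [Finset.empty_union, Finset.prod_empty, mul_one, if_true]
          exact ENNReal.div_self_le_one.trans le_self_add
        · rw [if_neg hne.ne_empty, zero_add]
          exact h S' (Finset.mem_powerset.1 hS') hne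
    _ ≤ 1 + 2 ^ Fintype.card S * ε := by
        rw [Finset.sum_add_distrib, Finset.sum_ite_eq', if_pos (Finset.empty_mem_powerset _),
          Finset.sum_const, Finset.card_powerset, nsmul_eq_mul, Nat.cast_pow, Nat.cast_ofNat]
        gcongr
        · norm_num
        · exact Finset.card_le_univ _

variable [∀ s, MeasurableSpace (κ s)]
  {ν : ∀ s, Measure (Alph s → κ s)} [∀ s, IsProbabilityMeasure (ν s)]

lemma pi_match_le {P B : Finset S} (hB : ∀ s ∉ B, Fintype.card (κ s) = 1)
    (hν : ∀ s, ∀ a a' : Alph s, a ≠ a' →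
      ν s {b | b a = b a'} ≤ (Fintype.card (κ s) : ENNReal)⁻¹) (z z' : ∀ s, Alph s) :
    open Classical in
    Measure.pi ν {b | ∀ s ∈ P, b s (z s) = b s (z' s)} *
        ∏ s ∈ P, (Fintype.card (κ s) : ENNReal) ≤
      ∑ S' ∈ (P ∩ B).powerset,
        if ∀ s ∈ S', z s = z' s then ∏ s ∈ S', (Fintype.card (κ s) : ENNReal) else 0 := by
  classical
  have hfactor : ∀ s, ν s {b | b (z s) = b (z' s)} * (Fintype.card (κ s) : ENNReal) ≤
      if s ∈ B ∧ z s = z' s then (Fintype.card (κ s) : ENNReal) else 1 := fun s => by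
    by_cases hs : s ∈ B
    · by_cases hz : z s = z' s
      · simp [hs, hz]
      · rw [if_neg fun h => hz h.2]
        exact (mul_le_mul_left (hν s _ _ hz) _).trans (ENNReal.inv_mul_le_one _)
    · simp [hs, hB s hs, prob_le_one]
  let S₀ := (P ∩ B).filter fun s => z s = z' s
  have hset : {b : ∀ s, Alph s → κ s | ∀ s ∈ P, b s (z s) = b s (z' s)} =
      Set.univ.pi fun s => if s ∈ P then {b | b (z s) = b (z' s)} else Set.univ := by
    ext b
    refine (forall_congr' fun s => ?_).trans Set.mem_univ_pi.symm
    split_ifs with h <;> simp [h]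
  calc Measure.pi ν {b | ∀ s ∈ P, b s (z s) = b s (z' s)} * ∏ s ∈ P, (Fintype.card (κ s) : ENNReal)
      = ∏ s ∈ P, ν s {b | b (z s) = b (z' s)} * (Fintype.card (κ s) : ENNReal) := by
        rw [hset, Measure.pi_pi, Finset.prod_mul_distrib]
        simp only [apply_ite, measure_univ, Finset.prod_ite_mem, Finset.univ_inter]
    _ ≤ ∏ s ∈ P, if s ∈ B ∧ z s = z' s then (Fintype.card (κ s) : ENNReal) else 1 :=
        Finset.prod_le_prod' fun s _ => hfactor s
    _ = ∏ s ∈ S₀, (Fintype.card (κ s) : ENNReal) := by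
        rw [← Finset.prod_filter]
        congr 1
        grind
    _ = if ∀ s ∈ S₀, z s = z' s then ∏ s ∈ S₀, (Fintype.card (κ s) : ENNReal) else 0 :=
        (if_pos fun s hs => (Finset.mem_filter.1 hs).2).symm
    _ ≤ _ := Finset.single_le_sum (f := fun S' : Finset S => if ∀ s ∈ S', z s = z' s then
          ∏ s ∈ S', (Fintype.card (κ s) : ENNReal) else 0) (fun _ _ => zero_le)
        (Finset.mem_powerset.2 (Finset.filter_subset _ _))

lemma pi_blockHash_eq_le {P U B : Finset S} (hB : ∀ s ∉ B, Fintype.card (κ s) = 1)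
    (hν : ∀ s, ∀ a a' : Alph s, a ≠ a' →
      ν s {b | b a = b a'} ≤ (Fintype.card (κ s) : ENNReal)⁻¹) (z z' : ∀ s, Alph s) :
    open Classical in
    Measure.pi ν {b | blockHash b P U z = blockHash b P U z'} *
        ∏ s ∈ P, (Fintype.card (κ s) : ENNReal) ≤
      ∑ S' ∈ (P ∩ B).powerset, if (S' ∪ U).restrict z = (S' ∪ U).restrict z' then
        ∏ s ∈ S', (Fintype.card (κ s) : ENNReal) else 0 := by
  classical
  by_cases hU : U.restrict z = U.restrict z'
  · refine (mul_le_mul_left (measure_mono fun b hb => ?_) _).trans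
      ((pi_match_le (P := P) hB hν z z').trans_eq ?_)
    · exact fun s hs => congrFun (Prod.mk.inj hb).2 ⟨s, hs⟩
    · refine Finset.sum_congr rfl fun S' _ => if_congr ?_ rfl rfl
      simp only [funext_iff, Finset.restrict, Subtype.forall, Finset.mem_union] at hU ⊢
      grind
  · have : {b : ∀ s, Alph s → κ s | blockHash b P U z = blockHash b P U z'} = ∅ :=
      Set.eq_empty_of_forall_notMem fun b hb => hU (Prod.mk.inj hb).1
    simp [this]

variable [∀ s, Countable (Alph s)] [∀ s, MeasurableSingletonClass (κ s)]

lemma lintegral_inv_binDensity_le (p : PMF (∀ s, Alph s)) {P U B : Finset S} {ε : ENNReal}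
    (hB : ∀ s ∉ B, Fintype.card (κ s) = 1)
    (hν : ∀ s, ∀ a a' : Alph s, a ≠ a' →
      ν s {b | b a = b a'} ≤ (Fintype.card (κ s) : ENNReal)⁻¹) {z : ∀ s, Alph s} (hz : p z ≠ 0)
    (hspread : IsSpread p κ P U B ε z) :
    ∫⁻ b, (binDensity p b P U z)⁻¹ ∂Measure.pi ν ≤ 1 + 2 ^ Fintype.card S * ε := by
  classical
  calc ∫⁻ b, (binDensity p b P U z)⁻¹ ∂Measure.pi ν
      = (∑' z', p z' * (Measure.pi ν {b | blockHash b P U z = blockHash b P U z'} *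
          ∏ s ∈ P, (Fintype.card (κ s) : ENNReal))) / marg p U z := by
        simp only [inv_binDensity _ P U hz, div_eq_mul_inv, mul_assoc]
        rw [lintegral_mul_const _ (measurable_map_blockHash p P U z), lintegral_map_blockHash]
        simp only [← mul_assoc, ENNReal.tsum_mul_right]
    _ ≤ (∑' z', p z' * ∑ S' ∈ (P ∩ B).powerset,
          if (S' ∪ U).restrict z = (S' ∪ U).restrict z' then
            ∏ s ∈ S', (Fintype.card (κ s) : ENNReal) else 0) / marg p U z := by
        gcongr with z'
        exact pi_blockHash_eq_le hB hν z z'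
    _ = ∑ S' ∈ (P ∩ B).powerset,
          marg p (S' ∪ U) z / marg p U z * ∏ s ∈ S', (Fintype.card (κ s) : ENNReal) := by
        simp only [Finset.mul_sum, div_eq_mul_inv]
        rw [Summable.tsum_finsetSum fun _ _ => ENNReal.summable, Finset.sum_mul]
        refine Finset.sum_congr rfl fun S' _ => ?_
        have hmarg : marg p (S' ∪ U) z =
            ∑' z', if (S' ∪ U).restrict z = (S' ∪ U).restrict z' then p z' else 0 :=
          (PMF.map_apply _ _ _).trans (tsum_congr fun z' => by congr)
        rw [mul_right_comm, hmarg]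
        simp only [← ENNReal.tsum_mul_right]
        simp only [mul_ite, ite_mul, mul_zero, zero_mul]
    _ ≤ 1 + 2 ^ Fintype.card S * ε := hspread.sum_powerset_le

lemma lintegral_tsum_indicator_inv_binDensity_le (p : PMF (∀ s, Alph s)) {P U B : Finset S}
    {ε : ENNReal} (hB : ∀ s ∉ B, Fintype.card (κ s) = 1)
    (hν : ∀ s, ∀ a a' : Alph s, a ≠ a' →
      ν s {b | b a = b a'} ≤ (Fintype.card (κ s) : ENNReal)⁻¹) {T : Set (∀ s, Alph s)}
    (hT : ∀ z ∈ T, IsSpread p κ P U B ε z) :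
    ∫⁻ b, ∑' z, T.indicator (fun z => p z * (binDensity p b P U z)⁻¹) z ∂Measure.pi ν ≤
      p.toOuterMeasure T * (1 + 2 ^ Fintype.card S * ε) := by
  have hmeas : ∀ z, Measurable fun b : (∀ s, Alph s → κ s) => (binDensity p b P U z)⁻¹ :=
    fun z => (measurable_binDensity p P U z).inv
  rw [PMF.toOuterMeasure_apply, ← ENNReal.tsum_mul_right, lintegral_tsum fun z => ?_]
  · refine ENNReal.tsum_le_tsum fun z => ?_
    rcases eq_or_ne (p z) 0 with hz | hz
    · simp [Set.indicator, hz]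
    by_cases hzT : z ∈ T
    · simp only [Set.indicator_of_mem hzT]
      rw [lintegral_const_mul _ (hmeas z)]
      exact mul_le_mul_right (lintegral_inv_binDensity_le p hB hν hz (hT z hzT)) _
    · simp [Set.indicator_of_notMem hzT]
  · by_cases hzT : z ∈ T
    · simpa only [Set.indicator_of_mem hzT] using ((hmeas z).const_mul (p z)).aemeasurable
    · simpa only [Set.indicator_of_notMem hzT] using aemeasurable_const

lemma toOuterMeasure_add_compl {α : Type*} (p : PMF α) (T : Set α) :
    p.toOuterMeasure T + p.toOuterMeasure Tᶜ = 1 := by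
  rw [PMF.toOuterMeasure_apply, PMF.toOuterMeasure_apply, ← ENNReal.tsum_add, ← p.tsum_coe]
  exact tsum_congr fun z => congrFun (Set.indicator_self_add_compl T p) z

variable [∀ s, Nonempty (κ s)]

lemma lintegral_one_sub_min_binDensity_le (p : PMF (∀ s, Alph s)) {P U B : Finset S} {ε : ENNReal}
    (hB : ∀ s ∉ B, Fintype.card (κ s) = 1)
    (hν : ∀ s, ∀ a a' : Alph s, a ≠ a' →
      ν s {b | b a = b a'} ≤ (Fintype.card (κ s) : ENNReal)⁻¹) {η : ℝ} (hη : 0 < η) :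
    ∫⁻ b, ∑' z, p z * (1 - min 1 (binDensity p b P U z)) ∂Measure.pi ν ≤
      p.toOuterMeasure {z | ¬IsSpread p κ P U B ε z} + ENNReal.ofReal η +
        (2 ^ Fintype.card S * ε + p.toOuterMeasure {z | ¬IsSpread p κ P U B ε z}) /
          ENNReal.ofReal η := by
  set T : Set (∀ s, Alph s) := {z | IsSpread p κ P U B ε z}
  have hTc : {z | ¬IsSpread p κ P U B ε z} = Tᶜ := rfl
  rw [hTc]
  have hsum := toOuterMeasure_add_compl p T
  have hT : p.toOuterMeasure T ≤ 1 := le_self_add.trans_eq hsum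
  have hcancel : p.toOuterMeasure T * (2 / ENNReal.ofReal η) ≠ ⊤ :=
    ENNReal.mul_ne_top (ne_top_of_le_ne_top ENNReal.one_ne_top hT)
      (ENNReal.div_ne_top ENNReal.ofNat_ne_top (ENNReal.ofReal_pos.2 hη).ne')
  have hnum : ∫⁻ b, ∑' z, T.indicator (fun z => p z * (binDensity p b P U z)⁻¹) z
      ∂Measure.pi ν + 1 ≤
        (2 ^ Fintype.card S * ε + p.toOuterMeasure Tᶜ) + p.toOuterMeasure T * 2 :=
    calc _ ≤ p.toOuterMeasure T * (1 + 2 ^ Fintype.card S * ε) +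
            (p.toOuterMeasure T + p.toOuterMeasure Tᶜ) :=
          add_le_add (lintegral_tsum_indicator_inv_binDensity_le p hB hν fun _ => id) hsum.ge
      _ = p.toOuterMeasure T * (2 ^ Fintype.card S * ε) + p.toOuterMeasure Tᶜ +
            p.toOuterMeasure T * 2 := by ring
      _ ≤ _ := by gcongr ?_ + _ + _; exact mul_le_of_le_one_left' hT
  refine (ENNReal.add_le_add_iff_right hcancel).1 ?_
  calc _ ≤ p.toOuterMeasure Tᶜ + ENNReal.ofReal η + (∫⁻ b, ∑' z,
          T.indicator (fun z => p z * (binDensity p b P U z)⁻¹) z ∂Measure.pi ν + 1) /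
            ENNReal.ofReal η := lintegral_one_sub_min_binDensity_add_le p P U _ T hη
    _ ≤ p.toOuterMeasure Tᶜ + ENNReal.ofReal η +
        ((2 ^ Fintype.card S * ε + p.toOuterMeasure Tᶜ) + p.toOuterMeasure T * 2) /
          ENNReal.ofReal η := by gcongr
    _ = _ := by rw [ENNReal.add_div, ← add_assoc, mul_div_assoc]

end Extraction

/-! ### Generating the sources from bin numbers -/

section Seeds

variable {S I : Type*} [Fintype S] [Fintype I] [DecidableEq S] [DecidableEq I]

lemma mem_privateMessages {A : Finset (S × I)} {s : S} {I' : Finset I} :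
    s ∈ privateMessages A I' ↔ encodersOf A s = I' := by
  simp [privateMessages]

lemma mem_messagesAt_iff {A : Finset (S × I)} {s : S} {i : I} :
    s ∈ messagesAt A i ↔ i ∈ encodersOf A s := by
  simp [messagesAt, encodersOf]

lemma encodersOf_mem_accessFamily (A : Finset (S × I)) (s : S) :
    encodersOf A s ∈ accessFamily A :=
  Finset.mem_filter.2 ⟨Finset.mem_univ _, s, mem_privateMessages.2 rfl⟩

lemma encodersOf_ssubset_encodersOf {A : Finset (S × I)} {s t : S}
    (h : t ∈ publicMessages A (encodersOf A s)) : encodersOf A s ⊂ encodersOf A t := by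
  obtain ⟨I'', hI'', ht⟩ := Finset.mem_biUnion.1 h
  exact mem_privateMessages.1 ht ▸ (Finset.mem_filter.1 hI'').2

lemma card_sub_card_encodersOf_lt {A : Finset (S × I)} {s t : S}
    (h : t ∈ publicMessages A (encodersOf A s)) :
    Fintype.card I - (encodersOf A t).card < Fintype.card I - (encodersOf A s).card := by
  have hlt := Finset.card_lt_card (encodersOf_ssubset_encodersOf h)
  have hle := (encodersOf A t).card_le_univ
  omega

/-- The arguments of the random functions that generate the sources from the bin numbers: a
block `I'`, the values of its public components and the bin numbers of its private ones. -/
abbrev SeedIndex (A : Finset (S × I)) (Alph κ : S → Type*) : Type _ :=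
  Σ I' : Finset I, (∀ s : publicMessages A I', Alph s) × (∀ s : privateMessages A I', κ s)

variable {A : Finset (S × I)} {Alph κ : S → Type*}

/-- The source values generated from the bin numbers `k` by the functions `ω`, proceeding
from the messages with the most encoders to those with the fewest. -/
def sourceOf (ω : SeedIndex A Alph κ → ∀ s, Alph s) (k : ∀ s, κ s) (s : S) : Alph s :=
  ω ⟨encodersOf A s, fun t => sourceOf ω k t, fun t => k t⟩ s
termination_by Fintype.card I - (encodersOf A s).card
decreasing_by exact card_sub_card_encodersOf_lt t.2

-- An encoder with access to `s` has access to all public messages of the block of `s`.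
lemma sourceOf_congr (ω : SeedIndex A Alph κ → ∀ s, Alph s) {k k' : ∀ s, κ s} {i : I}
    (h : ∀ t ∈ messagesAt A i, k t = k' t) (s : S) (hs : s ∈ messagesAt A i) :
    sourceOf ω k s = sourceOf ω k' s := by
  have hi := mem_messagesAt_iff.1 hs
  have hpublic : (fun t : publicMessages A (encodersOf A s) => sourceOf ω k t) =
      fun t : publicMessages A (encodersOf A s) => sourceOf ω k' t :=
    funext fun t => sourceOf_congr ω h t
      (mem_messagesAt_iff.2 ((encodersOf_ssubset_encodersOf t.2).subset hi))
  have hprivate : (fun t : privateMessages A (encodersOf A s) => k t) =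
      fun t : privateMessages A (encodersOf A s) => k' t :=
    funext fun t => h t (mem_messagesAt_iff.2 ((mem_privateMessages.1 t.2).symm ▸ hi))
  rw [sourceOf, sourceOf, hpublic, hprivate]
termination_by Fintype.card I - (encodersOf A s).card
decreasing_by exact card_sub_card_encodersOf_lt t.2

lemma sourceOf_eq_of_forall {ω : SeedIndex A Alph κ → ∀ s, Alph s} {k : ∀ s, κ s}
    {z : ∀ s, Alph s}
    (h : ∀ s, ω ⟨encodersOf A s, (publicMessages A (encodersOf A s)).restrict z,
      (privateMessages A (encodersOf A s)).restrict k⟩ s = z s) (s : S) :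
    sourceOf ω k s = z s := by
  have hpublic : (fun t : publicMessages A (encodersOf A s) => sourceOf ω k t) =
      (publicMessages A (encodersOf A s)).restrict z :=
    funext fun t => sourceOf_eq_of_forall h t
  rw [sourceOf, hpublic]
  exact h s
termination_by Fintype.card I - (encodersOf A s).card
decreasing_by exact card_sub_card_encodersOf_lt t.2

lemma sourceOf_eq_iff (ω : SeedIndex A Alph κ → ∀ s, Alph s) (k : ∀ s, κ s)
    (z : ∀ s, Alph s) :
    sourceOf ω k = z ↔ ∀ I' ∈ accessFamily A,
      (privateMessages A I').restrict
        (ω ⟨I', (publicMessages A I').restrict z, (privateMessages A I').restrict k⟩) =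
        (privateMessages A I').restrict z := by
  constructor
  · rintro rfl I' -
    funext ⟨s, hs⟩
    obtain rfl := mem_privateMessages.1 hs
    rw [Finset.restrict, Finset.restrict, sourceOf]
    rfl
  · exact fun h => funext (sourceOf_eq_of_forall fun s =>
      congrFun (h (encodersOf A s) (encodersOf_mem_accessFamily A s))
        ⟨s, mem_privateMessages.2 rfl⟩)

lemma setOf_sourceOf_eq [DecidableEq (SeedIndex A Alph κ)] (k : ∀ s, κ s) (z : ∀ s, Alph s) :
    {ω : SeedIndex A Alph κ → ∀ s, Alph s | sourceOf ω k = z} =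
      (((accessFamily A).image fun I' => ⟨I', (publicMessages A I').restrict z,
        (privateMessages A I').restrict k⟩ : Finset (SeedIndex A Alph κ)) : Set _).pi fun i =>
          {z' | (privateMessages A i.1).restrict z' = (privateMessages A i.1).restrict z} := by
  ext ω
  simp only [Set.mem_ofPred_eq, sourceOf_eq_iff, Set.mem_pi, Finset.mem_coe, Finset.mem_image]
  constructor
  · rintro h _ ⟨I', hI', rfl⟩
    exact h I' hI'
  · exact fun h I' hI' => h _ ⟨I', hI', rfl⟩

variable [∀ s, Countable (Alph s)] [∀ s, MeasurableSpace (Alph s)]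
  [∀ s, DiscreteMeasurableSpace (Alph s)]

lemma measurable_sourceOf (k : ∀ s, κ s) :
    Measurable fun ω : SeedIndex A Alph κ → ∀ s, Alph s => sourceOf ω k := by
  classical
  refine measurable_to_countable' fun z => ?_
  change MeasurableSet {ω : SeedIndex A Alph κ → ∀ s, Alph s | sourceOf ω k = z}
  rw [setOf_sourceOf_eq]
  exact .pi (Finset.countable_toSet _) fun i _ => (Set.to_countable _).measurableSet

variable [∀ s, Nonempty (Alph s)] [∀ s, MeasurableSpace (κ s)]
  (p : PMF (∀ s, Alph s)) (b : ∀ s, Alph s → κ s)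

/-- The law of the random functions that generate the sources from the bin numbers: their
values are independent, the value at `⟨I', u, v⟩` being distributed like `p` conditioned on the
public components of the block `I'` being `u` and the bins of its private components `v`. -/
def seedLaw (A : Finset (S × I)) : Measure (SeedIndex A Alph κ → ∀ s, Alph s) :=
  Measure.infinitePi fun i : SeedIndex A Alph κ =>
    condDistrib id (blockHash b (privateMessages A i.1) (publicMessages A i.1)) p.toMeasure i.2

instance : IsProbabilityMeasure (seedLaw p b A) := by
  unfold seedLaw
  infer_instance

lemma seedLaw_sourceOf_eq (k : ∀ s, κ s) (z : ∀ s, Alph s) :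
    seedLaw p b A {ω | sourceOf ω k = z} = ∏ I' ∈ accessFamily A,
      condDistrib id (blockHash b (privateMessages A I') (publicMessages A I')) p.toMeasure
        ((publicMessages A I').restrict z, (privateMessages A I').restrict k)
        {z' | (privateMessages A I').restrict z' = (privateMessages A I').restrict z} := by
  classical
  rw [setOf_sourceOf_eq, seedLaw,
    Measure.infinitePi_pi _ fun i _ => (Set.to_countable _).measurableSet,
    Finset.prod_image fun I' _ I'' _ h => congrArg Sigma.fst h]

lemma lintegral_sourceOf (k : ∀ s, κ s) (f : (∀ s, Alph s) → ENNReal) :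
    ∫⁻ ω, f (sourceOf ω k) ∂seedLaw p b A =
      ∑' z, seedLaw p b A {ω | sourceOf ω k = z} * f z := by
  rw [← lintegral_map (measurable_of_countable f) (measurable_sourceOf k), lintegral_countable']
  refine tsum_congr fun z => ?_
  rw [Measure.map_apply (measurable_sourceOf k) (measurableSet_singleton z), mul_comm]
  rfl

end Seeds

section ChangeOfMeasure

lemma condDistrib_blockHash {S : Type*} [Finite S] [DecidableEq S] {Alph κ : S → Type*}
    [∀ s, Countable (Alph s)] [∀ s, MeasurableSpace (Alph s)]
    [∀ s, DiscreteMeasurableSpace (Alph s)] [∀ s, Nonempty (Alph s)] [∀ s, Countable (κ s)]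
    [∀ s, MeasurableSpace (κ s)] [∀ s, MeasurableSingletonClass (κ s)]
    (p : PMF (∀ s, Alph s)) (b : ∀ s, Alph s → κ s) (P U : Finset S) {z : ∀ s, Alph s}
    (hz : p z ≠ 0) :
    condDistrib id (blockHash b P U) p.toMeasure (blockHash b P U z)
        {z' | P.restrict z' = P.restrict z} =
      marg p (P ∪ U) z / p.map (blockHash b P U) (blockHash b P U z) := by
  have hmeas : Measurable (blockHash b P U) := measurable_of_countable _
  have hmass : p.toMeasure.map (blockHash b P U) {blockHash b P U z} =
      p.map (blockHash b P U) (blockHash b P U z) := by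
    rw [PMF.toMeasure_map _ _ hmeas,
      PMF.toMeasure_apply_singleton _ _ (measurableSet_singleton _)]
  have hmarg : marg p (P ∪ U) z = p.toMeasure.map (P ∪ U).restrict {(P ∪ U).restrict z} := by
    rw [PMF.toMeasure_map _ _ (by fun_prop),
      PMF.toMeasure_apply_singleton _ _ (measurableSet_singleton _), marg]
  have hne : p.map (blockHash b P U) (blockHash b P U z) ≠ 0 :=
    (pos_iff_ne_zero.2 hz |>.trans_le (apply_le_map_apply p _ z)).ne'
  rw [condDistrib_apply_of_ne_zero measurable_id _ (hmass ▸ hne), hmass, ENNReal.div_eq_inv_mul,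
    Measure.map_apply (hmeas.prodMk measurable_id)
      ((measurableSet_singleton _).prod (Set.to_countable _).measurableSet), hmarg,
    Measure.map_apply (by fun_prop) (measurableSet_singleton _)]
  congr 2
  ext z'
  simp only [blockHash, Set.mem_preimage, Set.mem_prod, Set.mem_singleton_iff, Prod.mk.injEq,
    funext_iff, Finset.restrict, Subtype.forall, Finset.mem_union, Pi.map_apply, id_eq,
    Set.mem_ofPred_eq]
  grind

lemma one_sub_prod_le_sum {ι : Type*} (F : Finset ι) {t : ι → ENNReal} (ht : ∀ i, t i ≤ 1) :
    1 - ∏ i ∈ F, t i ≤ ∑ i ∈ F, (1 - t i) := by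
  classical
  induction F using Finset.induction_on with
  | empty => simp
  | insert a F ha ih =>
    rw [Finset.prod_insert ha, Finset.sum_insert ha, tsub_le_iff_right]
    calc (1 : ENNReal) = (1 - t a) + t a := (tsub_add_cancel_of_le (ht a)).symm
      _ ≤ (1 - t a) + t a * (∑ i ∈ F, (1 - t i) + ∏ i ∈ F, t i) := by
          gcongr
          exact le_mul_of_one_le_right' (tsub_le_iff_right.1 ih)
      _ ≤ (1 - t a) + ∑ i ∈ F, (1 - t i) + t a * ∏ i ∈ F, t i := by
          rw [mul_add, ← add_assoc]
          gcongr
          exact mul_le_of_le_one_left' (ht a)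

-- `q` has mass at most one and dominates the image of `p * t`, so that it can exceed the image of
-- `p` by at most the mass of `p * (1 - t)`.
lemma tsum_mul_le_of_mul_le {α β : Type*} (p : PMF α) {q : β → ENNReal} (hq : ∑' y, q y ≤ 1)
    {g : α → β} (hg : g.Injective) {t : α → ENNReal} (ht : ∀ x, t x ≤ 1)
    (hpq : ∀ x, p x * t x ≤ q (g x)) {e : β → ENNReal} (he : ∀ y, e y ≤ 1) :
    ∑' y, q y * e y ≤ ∑' x, p x * e (g x) + ∑' x, p x * (1 - t x) := by
  have hfinite : ∑' x, p x * t x * (1 - e (g x)) ≠ ⊤ := by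
    refine ne_top_of_le_ne_top ENNReal.one_ne_top ((ENNReal.tsum_le_tsum fun x => ?_).trans_eq
      p.tsum_coe)
    rw [mul_assoc]
    exact mul_le_of_le_one_right' (mul_le_one' (ht x) tsub_le_self)
  have hsplit : ∀ x, 1 ≤ e (g x) + (1 - t x) + t x * (1 - e (g x)) := fun x =>
    calc (1 : ENNReal) = (1 - t x) + t x * (e (g x) + (1 - e (g x))) := by
          rw [add_tsub_cancel_of_le (he _), mul_one, tsub_add_cancel_of_le (ht x)]
      _ ≤ (1 - t x) + (e (g x) + t x * (1 - e (g x))) := by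
          rw [mul_add]
          gcongr
          exact mul_le_of_le_one_left' (ht x)
      _ = _ := by ring
  refine (ENNReal.add_le_add_iff_right hfinite).1 ?_
  calc ∑' y, q y * e y + ∑' x, p x * t x * (1 - e (g x))
      ≤ ∑' y, q y * e y + ∑' y, q y * (1 - e y) := by
        gcongr
        calc ∑' x, p x * t x * (1 - e (g x)) ≤ ∑' x, q (g x) * (1 - e (g x)) :=
              ENNReal.tsum_le_tsum fun x => mul_le_mul_left (hpq x) _
          _ ≤ _ := ENNReal.tsum_comp_le_tsum_of_injective hg fun y => q y * (1 - e y)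
    _ = ∑' y, q y := by
        simp only [← ENNReal.tsum_add, ← mul_add, add_tsub_cancel_of_le (he _), mul_one]
    _ ≤ ∑' x, p x := hq.trans_eq p.tsum_coe.symm
    _ ≤ ∑' x, p x * (e (g x) + (1 - t x) + t x * (1 - e (g x))) :=
        ENNReal.tsum_le_tsum fun x => le_mul_of_one_le_right' (hsplit x)
    _ = _ := by simp only [mul_add, mul_assoc, ENNReal.tsum_add]

variable {S I : Type*} [Fintype S] [Fintype I] [DecidableEq S] [DecidableEq I]
  {A : Finset (S × I)} {Alph κ : S → Type*} [∀ s, Countable (Alph s)]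
  [∀ s, MeasurableSpace (Alph s)] [∀ s, DiscreteMeasurableSpace (Alph s)]
  [∀ s, Nonempty (Alph s)] [∀ s, Fintype (κ s)] [∀ s, MeasurableSpace (κ s)]

lemma tsum_prod_inv_card_mul_seedLaw [∀ s, Nonempty (κ s)] (p : PMF (∀ s, Alph s))
    (b : ∀ s, Alph s → κ s) :
    ∑' y : (∀ s, κ s) × (∀ s, Alph s), (∏ s, (Fintype.card (κ s) : ENNReal)⁻¹) *
      seedLaw p b A {ω | sourceOf ω y.1 = y.2} = 1 := by
  have hmass : ∀ k : (∀ s, κ s), ∑' z, seedLaw p b A {ω | sourceOf ω k = z} = 1 := fun k => by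
    simpa using (lintegral_sourceOf p b k fun _ => 1).symm
  rw [ENNReal.tsum_prod']
  simp only [ENNReal.tsum_mul_left, hmass, mul_one]
  exact (tsum_congr fun k => (uniformOfFintype_pi_apply k).symm).trans (PMF.tsum_coe _)

variable [∀ s, MeasurableSingletonClass (κ s)] {p : PMF (∀ s, Alph s)}

lemma mul_prod_min_binDensity_le
    (hp : ∀ z, p z = ∏ I' ∈ accessFamily A,
      marg p (privateMessages A I' ∪ publicMessages A I') z / marg p (publicMessages A I') z)
    (b : ∀ s, Alph s → κ s) (z : ∀ s, Alph s) :
    p z * ∏ I' ∈ accessFamily A,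
        min 1 (binDensity p b (privateMessages A I') (publicMessages A I') z) ≤
      (∏ s, (Fintype.card (κ s) : ENNReal)⁻¹) *
        seedLaw p b A {ω | sourceOf ω (Pi.map b z) = z} := by
  rcases eq_or_ne (p z) 0 with hz | hz
  · simp [hz]
  rw [hp z, seedLaw_sourceOf_eq, ← prod_accessFamily A, ← Finset.prod_mul_distrib,
    ← Finset.prod_mul_distrib]
  refine Finset.prod_le_prod' fun I' _ =>
    (mul_le_mul_right (min_le_right _ _) _).trans_eq ?_
  set P := privateMessages A I'
  set U := publicMessages A I'
  calc marg p (P ∪ U) z / marg p U z * binDensity p b P U z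
      = (marg p U z)⁻¹ * marg p U z * ((∏ s ∈ P, (Fintype.card (κ s) : ENNReal)⁻¹) *
          (marg p (P ∪ U) z / p.map (blockHash b P U) (blockHash b P U z))) := by
        simp only [binDensity, div_eq_mul_inv]
        ring
    _ = (∏ s ∈ P, (Fintype.card (κ s) : ENNReal)⁻¹) *
          (marg p (P ∪ U) z / p.map (blockHash b P U) (blockHash b P U z)) := by
        rw [ENNReal.inv_mul_cancel (marg_ne_zero U hz) (marg_ne_top p U z), one_mul]
    _ = _ := by rw [← condDistrib_blockHash p b P U hz]; rfl

variable [∀ s, Nonempty (κ s)]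

lemma lintegral_seedLaw_le
    (hp : ∀ z, p z = ∏ I' ∈ accessFamily A,
      marg p (privateMessages A I' ∪ publicMessages A I') z / marg p (publicMessages A I') z)
    (b : ∀ s, Alph s → κ s) {e : (∀ s, κ s) → (∀ s, Alph s) → ENNReal} (he : ∀ k z, e k z ≤ 1) :
    ∫⁻ ω, ∑ k, (∏ s, (Fintype.card (κ s) : ENNReal)⁻¹) * e k (sourceOf ω k) ∂seedLaw p b A ≤
      ∑' z, p z * e (Pi.map b z) z + ∑ I' ∈ accessFamily A, ∑' z, p z *
        (1 - min 1 (binDensity p b (privateMessages A I') (publicMessages A I') z)) := by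
  set c : ENNReal := ∏ s, (Fintype.card (κ s) : ENNReal)⁻¹
  calc ∫⁻ ω, ∑ k, c * e k (sourceOf ω k) ∂seedLaw p b A
      = ∑' y : (∀ s, κ s) × (∀ s, Alph s),
          c * seedLaw p b A {ω | sourceOf ω y.1 = y.2} * e y.1 y.2 := by
        have hmeas : ∀ k, Measurable fun ω : SeedIndex A Alph κ → ∀ s, Alph s =>
            e k (sourceOf ω k) :=
          fun k => (measurable_of_countable (e k)).comp (measurable_sourceOf k)
        rw [lintegral_finsetSum _ fun k _ => (hmeas k).const_mul c, ENNReal.tsum_prod',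
          tsum_fintype]
        refine Finset.sum_congr rfl fun k _ => ?_
        rw [lintegral_const_mul _ (hmeas k), lintegral_sourceOf p b]
        simp only [mul_assoc, ENNReal.tsum_mul_left]
    _ ≤ ∑' z, p z * e (Pi.map b z) z + ∑' z, p z * (1 - ∏ I' ∈ accessFamily A,
          min 1 (binDensity p b (privateMessages A I') (publicMessages A I') z)) :=
        tsum_mul_le_of_mul_le p (tsum_prod_inv_card_mul_seedLaw p b).le
          (g := fun z => (Pi.map b z, z))
          (fun z z' h => (Prod.mk.inj h).2)
          (fun z => Finset.prod_le_one' fun _ _ => min_le_left _ _)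
          (mul_prod_min_binDensity_le hp b) fun y => he y.1 y.2
    _ ≤ _ := by
        gcongr
        rw [← Summable.tsum_finsetSum fun _ _ => ENNReal.summable]
        refine ENNReal.tsum_le_tsum fun z => ?_
        rw [← Finset.mul_sum]
        gcongr
        exact one_sub_prod_le_sum _ fun _ => min_le_left _ _

end ChangeOfMeasure

/-! ### Typicality decoding -/

section Hashing

variable (α κ : Type*) [Fintype κ] [Nonempty κ] [MeasurableSpace κ]

/-- The law of a random function with independent uniform values. -/
def hashLaw : Measure (α → κ) :=
  Measure.infinitePi fun _ => (PMF.uniformOfFintype κ).toMeasure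

instance : IsProbabilityMeasure (hashLaw α κ) := by
  unfold hashLaw
  infer_instance

variable {α κ}

lemma hashLaw_collision_le [MeasurableSingletonClass κ] {a a' : α} (h : a ≠ a') :
    hashLaw α κ {b | b a = b a'} ≤ (Fintype.card κ : ENNReal)⁻¹ := by
  classical
  have hpair : ∀ k, hashLaw α κ {b | b a = k ∧ b a' = k} =
      (Fintype.card κ : ENNReal)⁻¹ * (Fintype.card κ : ENNReal)⁻¹ := fun k => by
    have hpi : {b : α → κ | b a = k ∧ b a' = k} =
        (({a, a'} : Finset α) : Set α).pi fun _ => {k} := by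
      ext b
      simp
    rw [hpi, hashLaw, Measure.infinitePi_pi _ fun _ _ => measurableSet_singleton k,
      Finset.prod_pair h, PMF.toMeasure_apply_singleton _ _ (measurableSet_singleton k),
      PMF.uniformOfFintype_apply]
  have hcard : (Fintype.card κ : ENNReal) ≠ 0 := by exact_mod_cast Fintype.card_ne_zero
  calc hashLaw α κ {b | b a = b a'} ≤ hashLaw α κ (⋃ k, {b | b a = k ∧ b a' = k}) :=
        measure_mono fun b hb => Set.mem_iUnion.2 ⟨b a, rfl, hb.symm⟩
    _ ≤ ∑ k, hashLaw α κ {b | b a = k ∧ b a' = k} := measure_iUnion_fintype_le _ _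
    _ = (Fintype.card κ : ENNReal)⁻¹ := by
        simp only [hpair]
        rw [Finset.sum_const, Finset.card_univ, nsmul_eq_mul, ← mul_assoc,
          ENNReal.mul_inv_cancel hcard (ENNReal.natCast_ne_top _), one_mul]

lemma map_fst_uniformOfFintype (κ κ' : Type*) [Fintype κ] [Nonempty κ] [Fintype κ']
    [Nonempty κ'] :
    (PMF.uniformOfFintype (κ × κ')).map Prod.fst = PMF.uniformOfFintype κ := by
  classical
  ext k
  have hcard : (Fintype.card κ' : ENNReal) ≠ 0 := by exact_mod_cast Fintype.card_ne_zero
  simp only [PMF.map_apply, PMF.uniformOfFintype_apply, tsum_fintype, Fintype.sum_prod_type,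
    Fintype.card_prod, Nat.cast_mul]
  change (∑ x : κ, ∑ _ : κ', if k = x then _ else _) = _
  simp only [Finset.sum_const, Finset.card_univ, nsmul_eq_mul, mul_ite, mul_zero,
    Finset.sum_ite_eq, Finset.mem_univ, if_true]
  rw [ENNReal.mul_inv (.inr (ENNReal.natCast_ne_top _)) (.inl (ENNReal.natCast_ne_top _)),
    mul_left_comm, ENNReal.mul_inv_cancel hcard (ENNReal.natCast_ne_top _), mul_one]

lemma map_fst_hashLaw (α κ κ' : Type*) [Fintype κ] [Nonempty κ] [MeasurableSpace κ]
    [Fintype κ'] [Nonempty κ'] [MeasurableSpace κ'] :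
    (hashLaw α (κ × κ')).map (fun b a => (b a).1) = hashLaw α κ := by
  rw [hashLaw, Measure.infinitePi_map_pi _ fun _ => measurable_fst]
  simp only [PMF.toMeasure_map _ _ measurable_fst, map_fst_uniformOfFintype, hashLaw]

lemma map_fst_pi_hashLaw {S : Type*} [Fintype S] (α κ κ' : S → Type*) [∀ s, Fintype (κ s)]
    [∀ s, Nonempty (κ s)] [∀ s, MeasurableSpace (κ s)] [∀ s, Fintype (κ' s)]
    [∀ s, Nonempty (κ' s)] [∀ s, MeasurableSpace (κ' s)] :
    (Measure.pi fun s => hashLaw (α s) (κ s × κ' s)).map (fun b s a => (b s a).1) =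
      Measure.pi fun s => hashLaw (α s) (κ s) := by
  have hmeas : ∀ s, AEMeasurable (fun (b : α s → κ s × κ' s) a => (b a).1)
      (hashLaw (α s) (κ s × κ' s)) := fun s => (by fun_prop : Measurable _).aemeasurable
  have : ∀ s, SigmaFinite ((hashLaw (α s) (κ s × κ' s)).map fun b a => (b a).1) := fun s => by
    rw [map_fst_hashLaw]
    infer_instance
  exact (Measure.pi_map_pi hmeas).trans
    (congrArg Measure.pi (funext fun s => map_fst_hashLaw _ _ _))

end Hashing

section Decoding

lemma exists_measurable_selection {Y Z : Type*} [MeasurableSpace Y] [Countable Z] [Nonempty Z]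
    [MeasurableSpace Z] (B : Z → Set Y) (hB : ∀ z, MeasurableSet (B z)) :
    ∃ ψ : Y → Z, Measurable ψ ∧ ∀ y, (∃ z, y ∈ B z) → y ∈ B (ψ y) := by
  classical
  obtain ⟨f, hf⟩ := exists_surjective_nat Z
  have hfind : ∀ y, ∃ n, y ∈ B (f n) ∨ ∀ m, y ∉ B (f m) := fun y => by
    by_cases h : ∃ n, y ∈ B (f n)
    · exact h.imp fun n hn => .inl hn
    · exact ⟨0, .inr (not_exists.1 h)⟩
  refine ⟨fun y => f (Nat.find (hfind y)), ?_, ?_⟩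
  · refine Measurable.find (f := fun n _ => f n) (p := fun n y => y ∈ B (f n) ∨ ∀ m, y ∉ B (f m))
      (fun n => measurable_const) (fun n => ?_) hfind
    have hset : {y | y ∈ B (f n) ∨ ∀ m, y ∉ B (f m)} = B (f n) ∪ ⋂ m, (B (f m))ᶜ := by
      ext y
      simp
    rw [hset]
    exact (hB _).union (.iInter fun m => (hB _).compl)
  · rintro y ⟨z, hz⟩
    obtain ⟨n, rfl⟩ := hf z
    exact (Nat.find_spec (hfind y)).resolve_right fun h => h n hz

variable {S J : Type*} [DecidableEq S] {Alph γ : S → Type*} [∀ s, MeasurableSpace (Alph s)]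
  {Y : J → Type*} [∀ j, MeasurableSpace (Y j)] {D : J → Finset S}
  (q : ∀ j (D' : Finset S), Kernel (Y j × (∀ s : ↥(D j \ D'), Alph s)) (∀ s : D', Alph s))
  (τ : Finset S → ENNReal) (N : Finset S)

/-- The sources `z` are likely given the channel output `y` at decoder `j`: for no `D' ⊆ D j` is
the posterior probability `q j D'` of the components in `D'`, given `y` and the other components
in `D j`, below the threshold `τ D'`. There is no condition on `D' ⊆ N`, as decoders need not
recover the components in `N`. -/
def IsLikely (j : J) (y : Y j) (z : ∀ s, Alph s) : Prop :=
  ∀ D' ⊆ D j, ¬ D' ⊆ N → τ D' ≤ q j D' (y, (D j \ D').restrict z) {D'.restrict z}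

/-- `ψ` is a typicality decoder at `j`: it finds sources that are likely and whose bin numbers
at `j` under the binning `c` are `k`, if there are any. -/
structure IsDecoder (c : ∀ s, Alph s → γ s) (k : ∀ s, γ s) (j : J) (ψ : Y j → ∀ s, Alph s) :
    Prop where
  measurable : Measurable ψ
  isLikely_and_match : ∀ y, (∃ z, IsLikely q τ N j y z ∧ ∀ s ∈ D j, c s (z s) = k s) →
    IsLikely q τ N j y (ψ y) ∧ ∀ s ∈ D j, c s (ψ y s) = k s

/-- A bound for the probability of decoding errors outside `N` when the sources are `z`: either
`z` itself is not likely, or some likely sources in the same bins differ from `z` exactly in the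
components `D'`. -/
def decodingBound [Fintype J] (out : (∀ s, Alph s) → Measure (∀ j, Y j))
    (c : ∀ s, Alph s → γ s) (z : ∀ s, Alph s) : ENNReal :=
  ∑ j, (out z {y | ¬ IsLikely q τ N j (y j) z} + ∑ D' ∈ (D j).powerset with ¬ D' ⊆ N,
    ∑' a : {a : ∀ s : D', Alph s // ∀ s, a s ≠ z s},
      {c' : ∀ s, Alph s → γ s | ∀ s : D', c' s (a.1 s) = c' s (z s)}.indicator
        (fun _ => out z {y | τ D' ≤ q j D' (y j, (D j \ D').restrict z) {a.1}}) c)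

lemma exists_competitor {c : ∀ s, Alph s → γ s} {z : ∀ s, Alph s} {j : J}
    {ψ : Y j → ∀ s, Alph s} (hψ : IsDecoder q τ N c (fun s => c s (z s)) j ψ) {y : Y j} {s : S}
    (hsD : s ∈ D j) (hsN : s ∉ N) (hs : ψ y s ≠ z s) (hz : IsLikely q τ N j y z) :
    ∃ D' ∈ (D j).powerset.filter (¬ · ⊆ N), ∃ a : {a : ∀ s : D', Alph s // ∀ s, a s ≠ z s},
      (∀ s : D', c s (a.1 s) = c s (z s)) ∧
        τ D' ≤ q j D' (y, (D j \ D').restrict z) {a.1} := by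
  classical
  obtain ⟨hlikely, hmatch⟩ := hψ.isLikely_and_match y ⟨z, hz, fun s _ => rfl⟩
  set D' := (D j).filter fun t => ψ y t ≠ z t
  have hD' : D' ⊆ D j := Finset.filter_subset _ _
  have hN : ¬ D' ⊆ N := fun h => hsN (h (Finset.mem_filter.2 ⟨hsD, hs⟩))
  have hagree : (D j \ D').restrict (ψ y) = (D j \ D').restrict z := funext fun t => by
    obtain ⟨ht, ht'⟩ := Finset.mem_sdiff.1 t.2
    by_contra h
    exact ht' (Finset.mem_filter.2 ⟨ht, h⟩)
  refine ⟨D', Finset.mem_filter.2 ⟨Finset.mem_powerset.2 hD', hN⟩,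
    ⟨D'.restrict (ψ y), fun t => (Finset.mem_filter.1 t.2).2⟩, fun t => hmatch t (hD' t.2), ?_⟩
  rw [← hagree]
  exact hlikely D' hD' hN

section ErrorBound

variable [Finite S] [∀ s, Countable (Alph s)] [Fintype J]
  (out : (∀ s, Alph s) → Measure (∀ j, Y j))

lemma measure_decodingError_le (c : ∀ s, Alph s → γ s) (z : ∀ s, Alph s)
    {ψ : ∀ j, Y j → ∀ s, Alph s} (hψ : ∀ j, IsDecoder q τ N c (fun s => c s (z s)) j (ψ j)) :
    out z {y | ∃ j, ∃ s ∈ D j, s ∉ N ∧ ψ j (y j) s ≠ z s} ≤ decodingBound q τ N out c z := by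
  calc out z {y | ∃ j, ∃ s ∈ D j, s ∉ N ∧ ψ j (y j) s ≠ z s}
      ≤ out z (⋃ j, ({y | ¬ IsLikely q τ N j (y j) z} ∪ ⋃ D' ∈ (D j).powerset.filter (¬ · ⊆ N),
          ⋃ a : {a : ∀ s : D', Alph s // ∀ s, a s ≠ z s},
            {y | (∀ s : D', c s (a.1 s) = c s (z s)) ∧
              τ D' ≤ q j D' (y j, (D j \ D').restrict z) {a.1}})) := by
        refine measure_mono fun y hy => ?_
        obtain ⟨j, s, hsD, hsN, hs⟩ := hy
        refine Set.mem_iUnion.2 ⟨j, or_iff_not_imp_left.2 fun hz => ?_⟩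
        obtain ⟨D', hD', a, ha⟩ :=
          exists_competitor q τ N (hψ j) hsD hsN hs (not_not.1 hz)
        exact Set.mem_biUnion hD' (Set.mem_iUnion.2 ⟨a, ha⟩)
    _ ≤ decodingBound q τ N out c z := by
        refine (measure_iUnion_fintype_le _ _).trans (Finset.sum_le_sum fun j _ =>
          (measure_union_le _ _).trans (add_le_add_right ((measure_biUnion_finset_le _ _).trans
            (Finset.sum_le_sum fun D' _ => (measure_iUnion_le _).trans
              (ENNReal.tsum_le_tsum fun a => ?_))) _))
        by_cases h : ∀ s : D', c s (a.1 s) = c s (z s)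
        · rw [Set.indicator_of_mem (by exact h)]
          exact measure_mono fun y hy => hy.2
        · exact (measure_mono_null (fun y hy => h hy.1) measure_empty).trans_le zero_le

end ErrorBound

variable [∀ s, Countable (Alph s)] [∀ s, DiscreteMeasurableSpace (Alph s)] [Finite S]

lemma measurableSet_isLikely (j : J) (z : ∀ s, Alph s) :
    MeasurableSet {y | IsLikely q τ N j y z} := by
  simp only [IsLikely, Set.ofPred_forall]
  exact .iInter fun D' => .iInter fun _ => .iInter fun _ => measurableSet_le measurable_const
    ((Kernel.measurable_coe _ (measurableSet_singleton _)).comp measurable_prodMk_right)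

lemma exists_isDecoder [∀ s, Nonempty (Alph s)] (c : ∀ s, Alph s → γ s) (k : ∀ s, γ s) (j : J) :
    ∃ ψ : Y j → ∀ s, Alph s, IsDecoder q τ N c k j ψ := by
  obtain ⟨ψ, hmeas, hψ⟩ := exists_measurable_selection
    (fun z => {y | IsLikely q τ N j y z ∧ ∀ s ∈ D j, c s (z s) = k s}) fun z =>
      (measurableSet_isLikely q τ N j z).inter (.const _)
  exact ⟨ψ, hmeas, hψ⟩

variable (out : (∀ s, Alph s) → Measure (∀ j, Y j))

lemma tsum_measure_le_inv [∀ j D', IsMarkovKernel (q j D')] [∀ z, IsProbabilityMeasure (out z)]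
    (j : J) {D' : Finset S} (hτ₀ : τ D' ≠ 0) (hτ : τ D' ≠ ⊤) (z : ∀ s, Alph s) :
    ∑' a, out z {y | τ D' ≤ q j D' (y j, (D j \ D').restrict z) {a}} ≤ (τ D')⁻¹ := by
  have hmeas : ∀ a : (∀ s : D', Alph s), Measurable fun y : (∀ j, Y j) =>
      q j D' (y j, (D j \ D').restrict z) {a} := fun a =>
    (Kernel.measurable_coe _ (measurableSet_singleton a)).comp
      (measurable_prodMk_right.comp (measurable_pi_apply j))
  have hmass : ∀ y : (∀ j, Y j), ∑' a, q j D' (y j, (D j \ D').restrict z) {a} = 1 := fun y => by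
    have h := lintegral_countable' (μ := q j D' (y j, (D j \ D').restrict z)) fun _ => 1
    simpa only [one_mul, lintegral_const, measure_univ, eq_comm] using h
  calc ∑' a, out z {y | τ D' ≤ q j D' (y j, (D j \ D').restrict z) {a}}
      ≤ ∑' a, (∫⁻ y, q j D' (y j, (D j \ D').restrict z) {a} ∂out z) / τ D' :=
        ENNReal.tsum_le_tsum fun a => meas_ge_le_lintegral_div (hmeas a).aemeasurable hτ₀ hτ
    _ = (∫⁻ y, ∑' a, q j D' (y j, (D j \ D').restrict z) {a} ∂out z) / τ D' := by
        rw [lintegral_tsum fun a => (hmeas a).aemeasurable]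
        simp only [div_eq_mul_inv, ENNReal.tsum_mul_right]
    _ = (τ D')⁻¹ := by simp only [hmass, lintegral_const, measure_univ, mul_one, one_div]

end Decoding

section RandomDecoding

variable {S J : Type*} {Alph γ : S → Type*} [∀ s, MeasurableSpace (γ s)]

section Match

variable [Fintype S] [∀ s, Fintype (γ s)] (ν : ∀ s, Measure (Alph s → γ s))
  [∀ s, IsProbabilityMeasure (ν s)]

lemma pi_forall_match_le
    (hν : ∀ s a a', a ≠ a' → ν s {c | c a = c a'} ≤ (Fintype.card (γ s) : ENNReal)⁻¹)
    {D' : Finset S} {a : ∀ s : D', Alph s} {z : ∀ s, Alph s} (h : ∀ s : D', a s ≠ z s) :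
    Measure.pi ν {c | ∀ s : D', c s (a s) = c s (z s)} ≤
      ∏ s ∈ D', (Fintype.card (γ s) : ENNReal)⁻¹ := by
  classical
  have hpi : {c : ∀ s, Alph s → γ s | ∀ s : D', c s (a s) = c s (z s)} =
      Set.univ.pi fun s => {c | ∀ h : s ∈ D', c (a ⟨s, h⟩) = c (z s)} := by
    ext c
    simp [Set.mem_pi, Subtype.forall]
  have hprod : ∏ s ∈ D', (Fintype.card (γ s) : ENNReal)⁻¹ =
      ∏ s, if s ∈ D' then (Fintype.card (γ s) : ENNReal)⁻¹ else 1 := by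
    rw [Finset.prod_ite_mem, Finset.univ_inter]
  rw [hpi, Measure.pi_pi, hprod]
  refine Finset.prod_le_prod' fun s _ => ?_
  split_ifs with hs
  · simpa [hs] using hν s _ _ (h ⟨s, hs⟩)
  · exact prob_le_one

end Match

variable [∀ s, MeasurableSingletonClass (γ s)]

lemma measurableSet_match [∀ s, Countable (γ s)] (D' : Finset S) (a : ∀ s : D', Alph s)
    (z : ∀ s, Alph s) :
    MeasurableSet {c : ∀ s, Alph s → γ s | ∀ s : D', c s (a s) = c s (z s)} := by
  rw [Set.ofPred_forall]
  exact .iInter fun s => measurableSet_eq_fun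
    ((measurable_pi_apply _).comp (measurable_pi_apply (s : S)))
    ((measurable_pi_apply _).comp (measurable_pi_apply (s : S)))

variable [DecidableEq S] [∀ s, Countable (Alph s)] [∀ s, MeasurableSpace (Alph s)] [Fintype J]
  {Y : J → Type*} [∀ j, MeasurableSpace (Y j)] {D : J → Finset S}
  (q : ∀ j (D' : Finset S), Kernel (Y j × (∀ s : ↥(D j \ D'), Alph s)) (∀ s : D', Alph s))
  {τ : Finset S → ENNReal} (N : Finset S) (out : (∀ s, Alph s) → Measure (∀ j, Y j))

lemma measurable_decodingBound [∀ s, Countable (γ s)] (z : ∀ s, Alph s) :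
    Measurable fun c : (∀ s, Alph s → γ s) => decodingBound q τ N out c z :=
  Finset.measurable_sum _ fun _ _ => measurable_const.add (Finset.measurable_sum _ fun D' _ =>
    Measurable.tsum fun a => measurable_const.indicator (measurableSet_match D' a.1 z))

variable [Fintype S] [∀ s, Fintype (γ s)] [∀ s, DiscreteMeasurableSpace (Alph s)]
  (ν : ∀ s, Measure (Alph s → γ s)) [∀ s, IsProbabilityMeasure (ν s)]

lemma lintegral_decodingBound_le [∀ j D', IsMarkovKernel (q j D')]
    [∀ z, IsProbabilityMeasure (out z)]
    (hν : ∀ s a a', a ≠ a' → ν s {c | c a = c a'} ≤ (Fintype.card (γ s) : ENNReal)⁻¹)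
    (hτ₀ : ∀ D', τ D' ≠ 0) (hτ : ∀ D', τ D' ≠ ⊤) (z : ∀ s, Alph s) :
    ∫⁻ c, decodingBound q τ N out c z ∂Measure.pi ν ≤
      ∑ j, (out z {y | ¬ IsLikely q τ N j (y j) z} + ∑ D' ∈ (D j).powerset with ¬ D' ⊆ N,
        (∏ s ∈ D', (Fintype.card (γ s) : ENNReal)⁻¹) * (τ D')⁻¹) := by
  have hmeas : ∀ j (D' : Finset S), Measurable fun c : (∀ s, Alph s → γ s) =>
      ∑' a : {a : ∀ s : D', Alph s // ∀ s, a s ≠ z s},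
        {c' : ∀ s, Alph s → γ s | ∀ s : D', c' s (a.1 s) = c' s (z s)}.indicator
          (fun _ => out z {y | τ D' ≤ q j D' (y j, (D j \ D').restrict z) {a.1}}) c :=
    fun j D' => .tsum fun a => measurable_const.indicator (measurableSet_match D' a.1 z)
  unfold decodingBound
  rw [lintegral_finsetSum]
  swap
  · exact fun j _ => measurable_const.add (Finset.measurable_sum _ fun D' _ => hmeas j D')
  refine Finset.sum_le_sum fun j _ => ?_
  rw [lintegral_add_left measurable_const, lintegral_const, measure_univ, mul_one,
    lintegral_finsetSum _ fun D' _ => hmeas j D']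
  refine add_le_add_right (Finset.sum_le_sum fun D' _ => ?_) _
  rw [lintegral_tsum]
  swap
  · exact fun a => (measurable_const.indicator (measurableSet_match D' a.1 z)).aemeasurable
  calc ∑' a : {a : ∀ s : D', Alph s // ∀ s, a s ≠ z s},
        ∫⁻ c, {c' : ∀ s, Alph s → γ s | ∀ s : D', c' s (a.1 s) = c' s (z s)}.indicator
          (fun _ => out z {y | τ D' ≤ q j D' (y j, (D j \ D').restrict z) {a.1}}) c ∂Measure.pi ν
      ≤ ∑' a : {a : ∀ s : D', Alph s // ∀ s, a s ≠ z s},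
          (∏ s ∈ D', (Fintype.card (γ s) : ENNReal)⁻¹) *
            out z {y | τ D' ≤ q j D' (y j, (D j \ D').restrict z) {a.1}} := by
        refine ENNReal.tsum_le_tsum fun a => ?_
        rw [lintegral_indicator_const (measurableSet_match D' a.1 z), mul_comm]
        gcongr
        exact pi_forall_match_le ν hν a.2
    _ ≤ (∏ s ∈ D', (Fintype.card (γ s) : ENNReal)⁻¹) * (τ D')⁻¹ := by
        rw [ENNReal.tsum_mul_left]
        gcongr
        exact (ENNReal.tsum_comp_le_tsum_of_injective Subtype.val_injective fun a =>
          out z {y | τ D' ≤ q j D' (y j, (D j \ D').restrict z) {a}}).trans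
            (tsum_measure_le_inv q τ out j (hτ₀ D') (hτ D') z)

end RandomDecoding

/-! ### Codes from random binning -/

section UniformSums

variable {S : Type*} [Fintype S] {κ κ' : S → Type*} [∀ s, Fintype (κ s)]
  [∀ s, Fintype (κ' s)]

lemma sum_prod_inv_card [∀ s, Nonempty (κ s)] [DecidableEq S] :
    ∑ _k : ∀ s, κ s, ∏ s, (Fintype.card (κ s) : ENNReal)⁻¹ = 1 := by
  rw [← PMF.tsum_coe (PMF.uniformOfFintype (∀ s, κ s)), tsum_fintype]
  exact Finset.sum_congr rfl fun k _ => (uniformOfFintype_pi_apply k).symm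

lemma sum_prod_inv_card_mul [DecidableEq S] (F : (∀ s, κ s) → (∀ s, κ' s) → ENNReal) :
    ∑ k : ∀ s, κ s × κ' s, (∏ s, (Fintype.card (κ s × κ' s) : ENNReal)⁻¹) *
      F (fun s => (k s).1) (fun s => (k s).2) =
    ∑ c, (∏ s, (Fintype.card (κ s) : ENNReal)⁻¹) *
      ∑ m, (∏ s, (Fintype.card (κ' s) : ENNReal)⁻¹) * F c m := by
  rw [← (Equiv.arrowProdEquivProdArrow S κ κ').symm.sum_comp, Fintype.sum_prod_type]
  refine Finset.sum_congr rfl fun c _ => ?_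
  rw [Finset.mul_sum]
  refine Finset.sum_congr rfl fun m _ => ?_
  simp only [Fintype.card_prod, Nat.cast_mul, ENNReal.mul_inv (.inr (ENNReal.natCast_ne_top _))
    (.inl (ENNReal.natCast_ne_top _)), Finset.prod_mul_distrib, mul_assoc]
  rfl

lemma exists_sum_le_of_sum_le [∀ s, Nonempty (κ s)] [DecidableEq S]
    {F : (∀ s, κ s) → (∀ s, κ' s) → ENNReal} {T : ENNReal}
    (h : ∑ k : ∀ s, κ s × κ' s, (∏ s, (Fintype.card (κ s × κ' s) : ENNReal)⁻¹) *
      F (fun s => (k s).1) (fun s => (k s).2) ≤ T) :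
    ∃ c, ∑ m, (∏ s, (Fintype.card (κ' s) : ENNReal)⁻¹) * F c m ≤ T := by
  rw [sum_prod_inv_card_mul] at h
  obtain ⟨c, -, hc⟩ := Finset.exists_min_image Finset.univ
    (fun c => ∑ m, (∏ s, (Fintype.card (κ' s) : ENNReal)⁻¹) * F c m) Finset.univ_nonempty
  refine ⟨c, le_trans ?_ h⟩
  calc ∑ m, (∏ s, (Fintype.card (κ' s) : ENNReal)⁻¹) * F c m
      = ∑ _c' : ∀ s, κ s, (∏ s, (Fintype.card (κ s) : ENNReal)⁻¹) *
          ∑ m, (∏ s, (Fintype.card (κ' s) : ENNReal)⁻¹) * F c m := by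
        rw [← Finset.sum_mul, sum_prod_inv_card, one_mul]
    _ ≤ _ := by
        gcongr ∑ c' : ∀ s, κ s, _ * ?_ with c'
        exact hc c' (Finset.mem_univ _)

end UniformSums

section CeilTwoRpow

lemma ceil_two_rpow_ne_zero (x : ℝ) : ⌈(2 : ℝ) ^ x⌉₊ ≠ 0 :=
  (Nat.ceil_pos.2 (by positivity)).ne'

lemma ceil_two_rpow_le {x : ℝ} (hx : 0 ≤ x) : (⌈(2 : ℝ) ^ x⌉₊ : ℝ) ≤ 2 * 2 ^ x := by
  have h1 := Real.one_le_rpow one_le_two hx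
  linarith [Nat.ceil_lt_add_one (show (0 : ℝ) ≤ 2 ^ x by positivity)]

lemma ceil_two_rpow_eq_one {x : ℝ} (hx : x ≤ 0) : ⌈(2 : ℝ) ^ x⌉₊ = 1 :=
  le_antisymm (Nat.ceil_le.2 (by simpa using Real.rpow_le_one_of_one_le_of_nonpos one_le_two hx))
    (Nat.one_le_iff_ne_zero.2 (ceil_two_rpow_ne_zero x))

lemma le_logb_ceil_div {n : ℕ} (hn : n ≠ 0) (x : ℝ) :
    x ≤ Real.logb 2 (⌈(2 : ℝ) ^ (n * x)⌉₊ : ℝ) / n := by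
  have hn' : (0 : ℝ) < n := by positivity
  rw [le_div_iff₀ hn', Real.le_logb_iff_rpow_le one_lt_two
    (by exact_mod_cast Nat.pos_of_ne_zero (ceil_two_rpow_ne_zero _)), mul_comm]
  exact Nat.le_ceil _

end CeilTwoRpow

section Enlarge

variable {S I J : Type*} [Fintype S] [Fintype J] [DecidableEq S] [DecidableEq I]
  {X : I → Type*} {Y : ℕ → J → Type*} [∀ n j, MeasurableSpace (Y n j)]
  {A : Finset (S × I)} {D : J → Finset S} {n : ℕ}

/-- The code `E` with every message `s` extended by a message from a set of `t s` elements that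
the encoders ignore. -/
def Code.enlarge (E : Code A D X Y n) (t : S → ℕ) [∀ s, NeZero (t s)] : Code A D X Y n where
  size s := E.size s * t s
  size_pos s := Nat.mul_pos (E.size_pos s) (NeZero.pos (t s))
  enc i m := E.enc i fun s => (finProdFinEquiv.symm (m s)).1
  dec j := (E.dec j).map fun m s => finProdFinEquiv (m s, 0)
  dec_markov j :=
    have := E.dec_markov j
    Kernel.IsMarkovKernel.map _ (measurable_of_countable _)

lemma Code.pi_dec_enlarge_le (E : Code A D X Y n) {t : S → ℕ} [∀ s, NeZero (t s)]
    (ht : ∀ j, ∀ s ∈ D j, t s = 1) (y : ∀ j, Y n j) (m : ∀ s, Fin (E.size s * t s)) :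
    Measure.pi (fun j => (E.enlarge t).dec j (y j)) {mhat | ∃ j, ∃ s : D j, mhat j s ≠ m s} ≤
      Measure.pi (fun j => E.dec j (y j))
        {mhat | ∃ j, ∃ s : D j, mhat j s ≠ (finProdFinEquiv.symm (m s)).1} := by
  have := E.dec_markov
  have hmeas : ∀ j, Measurable fun (mhat : ∀ s : D j, Fin (E.size s)) (s : D j) =>
      finProdFinEquiv (mhat s, (0 : Fin (t s))) := fun j => measurable_of_countable _
  have hdec : Measure.pi (fun j => (E.enlarge t).dec j (y j)) =
      (Measure.pi fun j => E.dec j (y j)).map fun mhat j (s : D j) =>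
        finProdFinEquiv (mhat j s, (0 : Fin (t s))) :=
    (congrArg Measure.pi (funext fun j => Kernel.map_apply _ (hmeas j) _)).trans
      (Measure.pi_map_pi fun j => (hmeas j).aemeasurable).symm
  calc Measure.pi (fun j => (E.enlarge t).dec j (y j)) {mhat | ∃ j, ∃ s : D j, mhat j s ≠ m s}
      = (Measure.pi fun j => E.dec j (y j))
          {mhat | ∃ j, ∃ s : D j, finProdFinEquiv (mhat j s, (0 : Fin (t s))) ≠ m s} :=
        (congrArg (fun μ : Measure (∀ j, ∀ s : D j, Fin (E.size s * t s)) =>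
          μ {mhat | ∃ j, ∃ s : D j, mhat j s ≠ m s}) hdec).trans
          (Measure.map_apply (by fun_prop) (Set.toFinite _).measurableSet)
    _ ≤ _ := by
        refine measure_mono fun mhat ⟨j, s, hs⟩ => ⟨j, s, fun h => hs ?_⟩
        have : Subsingleton (Fin (t s)) := by rw [ht j s s.2]; infer_instance
        rw [← Equiv.eq_symm_apply]
        exact Prod.ext h (Subsingleton.elim _ _)

variable [Fintype I]

lemma Code.errorProb_enlarge_le [∀ i, Fintype (X i)] (E : Code A D X Y n) (W : Channel X Y)
    {t : S → ℕ} [∀ s, NeZero (t s)] (ht : ∀ j, ∀ s ∈ D j, t s = 1) :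
    (E.enlarge t).errorProb W ≤ E.errorProb W := by
  have := E.dec_markov
  have := E.nonempty_fin_size
  let F : (∀ s, Fin (E.size s)) → ENNReal := fun m =>
    ∑ x : (∀ i, Fin n → X i), (∏ i, E.enc i ((messagesAt A i).restrict m) (x i)) *
      ∫⁻ y, Measure.pi (fun j => E.dec j (y j))
        {mhat | ∃ j, ∃ s : D j, mhat j s ≠ m s} ∂(W n x : Measure (∀ j, Y n j))
  calc (E.enlarge t).errorProb W
      ≤ ∑ m : (∀ s, Fin (E.size s * t s)), (∏ s, ((E.size s * t s : ℕ) : ENNReal)⁻¹) *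
          F fun s => (finProdFinEquiv.symm (m s)).1 := by
        refine Finset.sum_le_sum fun (m : ∀ s, Fin (E.size s * t s)) _ => ?_
        refine mul_le_mul_right (Finset.sum_le_sum fun x _ => mul_le_mul_right ?_ _) _
        exact lintegral_mono fun y => E.pi_dec_enlarge_le ht y m
    _ = ∑ k : ∀ s, Fin (E.size s) × Fin (t s),
          (∏ s, (Fintype.card (Fin (E.size s) × Fin (t s)) : ENNReal)⁻¹) *
            F fun s => (k s).1 := by
        rw [← (Equiv.piCongrRight fun _ => finProdFinEquiv).sum_comp]
        simp
    _ = E.errorProb W := by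
        rw [sum_prod_inv_card_mul (fun c _ => F c)]
        simp only [← Finset.sum_mul, sum_prod_inv_card, one_mul]
        simp only [Fintype.card_fin]
        rfl

lemma HasGoodCode.of_eq_on_demanded [∀ i, Fintype (X i)] {W : Channel X Y} {R R' : S → ℝ}
    {ε : ℝ} (h : HasGoodCode A D W R n ε) (hn : n ≠ 0) (hε : 0 < ε)
    (hR : ∀ j, ∀ s ∈ D j, R' s = R s) : HasGoodCode A D W R' n ε := by
  classical
  obtain ⟨E, hrate, herr⟩ := h
  let t : S → ℕ := fun s => if ∃ j, s ∈ D j then 1 else ⌈(2 : ℝ) ^ (n * R' s)⌉₊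
  have : ∀ s, NeZero (t s) := fun s => ⟨by
    dsimp only [t]
    split_ifs
    exacts [one_ne_zero, ceil_two_rpow_ne_zero _]⟩
  refine ⟨E.enlarge t, fun s => ?_,
    (E.errorProb_enlarge_le W fun j s hs => if_pos ⟨j, hs⟩).trans herr⟩
  by_cases hs : ∃ j, s ∈ D j
  · obtain ⟨j, hj⟩ := hs
    simpa [Code.enlarge, t, show ∃ j, s ∈ D j from ⟨j, hj⟩, hR j s hj] using hrate s
  · have hpos : (0 : ℝ) < ⌈(2 : ℝ) ^ (n * R' s)⌉₊ :=
      Nat.cast_pos.2 (Nat.pos_of_ne_zero (ceil_two_rpow_ne_zero _))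
    have hsize : (1 : ℝ) ≤ E.size s := Nat.one_le_cast.2 (E.size_pos s)
    calc R' s - ε ≤ R' s := sub_le_self _ hε.le
      _ ≤ Real.logb 2 ⌈(2 : ℝ) ^ (n * R' s)⌉₊ / n := le_logb_ceil_div hn _
      _ ≤ Real.logb 2 ((E.enlarge t).size s) / n := by
        simp only [Code.enlarge, t, if_neg hs, Nat.cast_mul]
        gcongr
        · norm_num
        · exact le_mul_of_one_le_left hpos.le hsize

end Enlarge

section OneShot

variable {S I J : Type*} [Fintype S] [Fintype I] [DecidableEq S] [DecidableEq I]
  {X : I → Type*} {Y : ℕ → J → Type*} [∀ n j, MeasurableSpace (Y n j)]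
  {A : Finset (S × I)} {D : J → Finset S} (Z : AuxSources A X) (n : ℕ) {C L : S → ℕ}
  [∀ s, NeZero (L s)]

section FixedBins

variable (b : ∀ s, Z.Alph n s → Fin (C s) × Fin (L s)) (c : ∀ s, Fin (C s))
  (ω : SeedIndex A (Z.Alph n) (fun s => Fin (C s) × Fin (L s)) → ∀ s, Z.Alph n s)
  {ψ : ∀ j, Y n j → ∀ s, Z.Alph n s} (hψ : ∀ j, Measurable (ψ j))

/-- The binning code. The bin number of message `s` has a part `c s` that is shared by encoders
and decoders, and the message as its other part. The encoders generate the sources from the bin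
numbers by the functions `ω`, and decoder `j` bins the sources that are estimated by `ψ j`. -/
def binningCode : Code A D X Y n where
  size := L
  size_pos s := NeZero.pos (L s)
  enc i m := Z.input n i ((messagesAt A i).restrict
    (sourceOf ω fun s => (c s, if h : s ∈ messagesAt A i then m ⟨s, h⟩ else 0)))
  dec j := Kernel.deterministic (fun y (s : D j) => (b s (ψ j y s)).2)
    ((measurable_of_countable fun (z : ∀ s, Z.Alph n s) (s : D j) => (b s (z s)).2).comp (hψ j))
  dec_markov _ := inferInstance

lemma binningCode_enc (m : ∀ s, Fin (L s)) (i : I) :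
    (binningCode (D := D) Z n b c ω hψ).enc i ((messagesAt A i).restrict m) =
      Z.input n i ((messagesAt A i).restrict (sourceOf ω fun s => (c s, m s))) :=
  congrArg (Z.input n i) <| funext fun s =>
    sourceOf_congr ω (fun t ht => congrArg (Prod.mk (c t)) (dif_pos ht)) s s.2

variable [Fintype J]

lemma pi_binningCode_dec (y : ∀ j, Y n j) :
    Measure.pi (fun j => (binningCode (D := D) Z n b c ω hψ).dec j (y j)) =
      Measure.dirac fun j (s : D j) => (b s (ψ j (y j) s)).2 :=
  (Measure.infinitePi_eq_pi (μ := fun j =>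
    Measure.dirac fun s : D j => (b s (ψ j (y j) s)).2)).symm.trans (Measure.infinitePi_dirac _)

lemma errorProb_binningCode_le [∀ i, Fintype (X i)] (W : Channel X Y) :
    (binningCode (D := D) Z n b c ω hψ).errorProb W ≤
      ∑ m : (∀ s, Fin (L s)), (∏ s, (Fintype.card (Fin (L s)) : ENNReal)⁻¹) *
        Z.output W n (sourceOf ω fun s => (c s, m s))
          {y | ∃ j, ∃ s : D j, (b s (ψ j (y j) s)).2 ≠ m s} := by
  simp only [Fintype.card_fin]
  refine Finset.sum_le_sum fun (m : ∀ s, Fin (L s)) _ => mul_le_mul_right ?_ _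
  rw [AuxSources.output, Measure.finsetSum_apply]
  refine Finset.sum_le_sum fun x _ => ?_
  rw [Measure.smul_apply, smul_eq_mul]
  refine mul_le_mul' (Finset.prod_congr rfl fun i _ =>
    congrArg (· (x i)) (binningCode_enc Z n b c ω hψ m i)).le ?_
  refine le_trans (lintegral_mono fun y => le_of_eq ?_) (lintegral_indicator_one_le _)
  rw [pi_binningCode_dec]
  exact Measure.dirac_apply' _ (Set.toFinite {mhat : ∀ j, ∀ s : D j, Fin (L s) |
    ∃ j, ∃ s : D j, mhat j s ≠ m s}).measurableSet

end FixedBins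

variable [∀ i, Fintype (X i)] (W : Channel X Y) (q : ∀ j (D' : Finset S),
    Kernel (Y n j × (∀ s : ↥(D j \ D'), Z.Alph n s)) (∀ s : D', Z.Alph n s))
  (τ : Finset S → ENNReal) {N : Finset S}

lemma AuxSources.tsum_law_mul_not_isLikely (j : J) :
    ∑' z, Z.law n z * Z.output W n z {y | ¬ IsLikely q τ N j (y j) z} =
      Z.joint W n {ω | ¬ IsLikely q τ N j (ω.2 j) ω.1} := by
  have hmeas : MeasurableSet {ω : (∀ s, Z.Alph n s) × (∀ j, Y n j) |
      ¬ IsLikely q τ N j (ω.2 j) ω.1} := by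
    refine MeasurableSet.compl (measurableSet_setOfPred.2 ?_)
    refine measurable_from_prod_countable_right fun z => measurableSet_setOfPred.1 ?_
    exact (measurableSet_isLikely q τ N j z).preimage (measurable_pi_apply j)
  exact (Z.joint_apply W n hmeas).symm

variable [Fintype J] [∀ s, NeZero (C s)]

lemma exists_code_of_binning (hN : ∀ s ∈ N, L s = 1)
    (b : ∀ s, Z.Alph n s → Fin (C s) × Fin (L s)) :
    ∃ E : Code A D X Y n, E.size = L ∧ E.errorProb W ≤
      ∑' z, Z.law n z * decodingBound q τ N (Z.output W n) (fun s a => (b s a).1) z +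
      ∑ I' ∈ accessFamily A, ∑' z, Z.law n z *
        (1 - min 1 (binDensity (Z.law n) b (privateMessages A I') (publicMessages A I') z)) := by
  choose ψ hψ using fun (c : ∀ s, Fin (C s)) (j : J) =>
    exists_isDecoder q τ N (fun s a => (b s a).1) c j
  set e : (∀ s, Fin (C s) × Fin (L s)) → (∀ s, Z.Alph n s) → ENNReal := fun k z =>
    Z.output W n z {y | ∃ j, ∃ s : D j, (b s (ψ (fun s => (k s).1) j (y j) s)).2 ≠ (k s).2}
  have he : ∀ z, e (Pi.map b z) z ≤
      decodingBound q τ N (Z.output W n) (fun s a => (b s a).1) z := fun z => by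
    refine le_trans (measure_mono fun y ⟨j, s, hs⟩ => ?_)
      (measure_decodingError_le q τ N _ _ z fun j => hψ (fun s => (b s (z s)).1) j)
    refine ⟨j, s, s.2, fun hsN => hs ?_, fun h => hs (by rw [Pi.map_apply, ← h]; rfl)⟩
    have : Subsingleton (Fin (L s)) := by rw [hN s hsN]; infer_instance
    exact Subsingleton.elim _ _
  have hmeas : ∀ k, Measurable fun ω : SeedIndex A (Z.Alph n) (fun s => Fin (C s) × Fin (L s)) →
      ∀ s, Z.Alph n s => e k (sourceOf ω k) :=
    fun k => (measurable_of_countable (e k)).comp (measurable_sourceOf k)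
  obtain ⟨ω, hω⟩ := exists_le_lintegral (μ := seedLaw (Z.law n) b A)
    (Finset.measurable_sum Finset.univ fun k _ =>
      (hmeas k).const_mul (∏ s, (Fintype.card (Fin (C s) × Fin (L s)) : ENNReal)⁻¹)).aemeasurable
  obtain ⟨c, hc⟩ := exists_sum_le_of_sum_le (F := fun c m =>
      Z.output W n (sourceOf ω fun s => (c s, m s))
        {y | ∃ j, ∃ s : D j, (b s (ψ c j (y j) s)).2 ≠ m s})
    (hω.trans (lintegral_seedLaw_le (Z.factorizes n) b fun k z => prob_le_one))
  refine ⟨binningCode Z n b c ω fun j => (hψ c j).measurable, rfl,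
    (errorProb_binningCode_le Z n b c ω _ W).trans (hc.trans ?_)⟩
  gcongr
  exact he _

variable {τ} [∀ j D', IsMarkovKernel (q j D')]

lemma lintegral_tsum_decodingBound_le {γ : S → Type*} [∀ s, Fintype (γ s)]
    [∀ s, MeasurableSpace (γ s)] [∀ s, MeasurableSingletonClass (γ s)]
    {ν : ∀ s, Measure (Z.Alph n s → γ s)} [∀ s, IsProbabilityMeasure (ν s)]
    (hν : ∀ s a a', a ≠ a' → ν s {c | c a = c a'} ≤ (Fintype.card (γ s) : ENNReal)⁻¹)
    (hτ₀ : ∀ D', τ D' ≠ 0) (hτ : ∀ D', τ D' ≠ ⊤) :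
    ∫⁻ c, ∑' z, Z.law n z * decodingBound q τ N (Z.output W n) c z ∂Measure.pi ν ≤
      ∑ j, (Z.joint W n {ω | ¬ IsLikely q τ N j (ω.2 j) ω.1} +
        ∑ D' ∈ (D j).powerset with ¬ D' ⊆ N,
          (∏ s ∈ D', (Fintype.card (γ s) : ENNReal)⁻¹) * (τ D')⁻¹) := by
  have hmeas := measurable_decodingBound (γ := γ) (τ := τ) q N (Z.output W n)
  rw [lintegral_tsum fun z => ((hmeas z).const_mul _).aemeasurable]
  calc ∑' z, ∫⁻ c, Z.law n z * decodingBound q τ N (Z.output W n) c z ∂Measure.pi ν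
      ≤ ∑' z, Z.law n z * ∑ j, (Z.output W n z {y | ¬ IsLikely q τ N j (y j) z} +
          ∑ D' ∈ (D j).powerset with ¬ D' ⊆ N,
            (∏ s ∈ D', (Fintype.card (γ s) : ENNReal)⁻¹) * (τ D')⁻¹) := by
        refine ENNReal.tsum_le_tsum fun z => ?_
        rw [lintegral_const_mul _ (hmeas z)]
        exact mul_le_mul_right (lintegral_decodingBound_le q N _ ν hν hτ₀ hτ z) _
    _ = _ := by
        simp only [Finset.mul_sum (s := Finset.univ), mul_add]
        rw [Summable.tsum_finsetSum fun _ _ => ENNReal.summable]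
        refine Finset.sum_congr rfl fun j _ => ?_
        rw [ENNReal.tsum_add, Z.tsum_law_mul_not_isLikely n W q τ j, ENNReal.tsum_mul_right,
          (Z.law n).tsum_coe, one_mul]

lemma exists_code (B : Finset S) (hB : ∀ s ∉ B, C s * L s = 1) (hN : ∀ s ∈ N, L s = 1)
    (hτ₀ : ∀ D', τ D' ≠ 0) (hτ : ∀ D', τ D' ≠ ⊤) (ε : ENNReal) {η : ℝ} (hη : 0 < η) :
    ∃ E : Code A D X Y n, E.size = L ∧ E.errorProb W ≤
      ∑ j, (Z.joint W n {ω | ¬ IsLikely q τ N j (ω.2 j) ω.1} +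
        ∑ D' ∈ (D j).powerset with ¬ D' ⊆ N, (∏ s ∈ D', (C s : ENNReal)⁻¹) * (τ D')⁻¹) +
      ∑ I' ∈ accessFamily A,
        ((Z.law n).toOuterMeasure {z | ¬ IsSpread (Z.law n) (fun s => Fin (C s) × Fin (L s))
            (privateMessages A I') (publicMessages A I') B ε z} + ENNReal.ofReal η +
          (2 ^ Fintype.card S * ε + (Z.law n).toOuterMeasure {z | ¬ IsSpread (Z.law n)
            (fun s => Fin (C s) × Fin (L s)) (privateMessages A I') (publicMessages A I')
              B ε z}) / ENNReal.ofReal η) := by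
  set μ := Measure.pi fun s => hashLaw (Z.Alph n s) (Fin (C s) × Fin (L s))
  have hdecode := lintegral_tsum_decodingBound_le Z n W q (N := N) (τ := τ)
    (fun s a a' h => hashLaw_collision_le (κ := Fin (C s)) h) hτ₀ hτ
  have hmeasG : Measurable fun c : (∀ s, Z.Alph n s → Fin (C s)) =>
      ∑' z, Z.law n z * decodingBound q τ N (Z.output W n) c z :=
    .tsum fun z => (measurable_decodingBound q N (Z.output W n) z).const_mul _
  have hmeasF : ∀ I', Measurable fun b : (∀ s, Z.Alph n s → Fin (C s) × Fin (L s)) =>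
      ∑' z, Z.law n z * (1 - min 1 (binDensity (Z.law n) b (privateMessages A I')
        (publicMessages A I') z)) := fun I' =>
    .tsum fun z => ((measurable_const.min (measurable_binDensity _ _ _ z)).const_sub 1).const_mul _
  have hmeasG' : Measurable fun b : (∀ s, Z.Alph n s → Fin (C s) × Fin (L s)) =>
      ∑' z, Z.law n z * decodingBound q τ N (Z.output W n) (fun s a => (b s a).1) z :=
    hmeasG.comp (by fun_prop)
  rw [← map_fst_pi_hashLaw _ _ fun s => Fin (L s), lintegral_map hmeasG (by fun_prop)] at hdecode
  simp only [Fintype.card_fin] at hdecode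
  obtain ⟨b, hb⟩ := exists_le_lintegral (μ := μ)
    (hmeasG'.fun_add (Finset.measurable_sum (accessFamily A) fun I' _ => hmeasF I')).aemeasurable
  rw [lintegral_add_right _ (Finset.measurable_sum _ fun I' _ => hmeasF I'),
    lintegral_finsetSum _ fun I' _ => hmeasF I'] at hb
  obtain ⟨E, hE, herr⟩ := exists_code_of_binning Z n W q τ hN b
  refine ⟨E, hE, herr.trans (hb.trans (add_le_add hdecode (Finset.sum_le_sum fun I' _ => ?_)))⟩
  exact lintegral_one_sub_min_binDensity_le (Z.law n)
    (fun s hs => by rw [Fintype.card_prod, Fintype.card_fin, Fintype.card_fin, hB s hs])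
    (fun s a a' h => hashLaw_collision_le h) hη

end OneShot

/-! ### Rates and the direct part -/

section BinRates

variable {S : Type*}

lemma exists_pos_le_of_pos [Finite S] (R : S → ℝ) {ε : ℝ} (hε : 0 < ε) :
    ∃ δ > 0, δ ≤ ε ∧ ∀ s, 0 < R s → δ ≤ R s := by
  have h : ∀ᶠ δ in 𝓝[>] (0 : ℝ), 0 < δ ∧ δ ≤ ε ∧ ∀ s, 0 < R s → δ ≤ R s := by
    refine eventually_mem_nhdsWithin.and ((eventually_nhdsWithin_of_eventually_nhds
      (eventually_le_nhds hε)).and (eventually_all.2 fun s => ?_))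
    by_cases hs : 0 < R s
    · exact eventually_nhdsWithin_of_eventually_nhds
        ((eventually_le_nhds hs).mono fun _ hδ _ => hδ)
    · exact .of_forall fun _ h => absurd h hs
  exact h.exists

/-- Rates `ρ` and `l` of the two parts of the bin numbers of a random binning code: the part that
is shared by the encoders and the decoders, and the message. The message rates are within `ε` of
`R`, the rates of the bins stay below `R + r`, and those of the shared parts exceed `r`, both with
the margin `2 * g`. Sets of messages of rate `0` are exempted from the last condition, since such
messages need not be decoded. -/
structure IsBinRates (R r : S → ℝ) (ε g : ℝ) (ρ l : S → ℝ) : Prop where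
  nonneg s : 0 ≤ l s
  eq_zero {s} : R s = 0 → l s = 0
  sub_le s : R s - ε ≤ l s
  add_le s : ρ s + l s ≤ R s + r s - 2 * g
  sum_add_le {D' : Finset S} {u : S} : u ∈ D' → R u ≠ 0 → ∑ s ∈ D', r s + 2 * g ≤ ∑ s ∈ D', ρ s

lemma sum_add_le_sum_of_sub_le {D' : Finset S} {r ρ : S → ℝ} {c : ℝ} (hc : 0 ≤ c)
    (h : ∀ s ∈ D', r s - c ≤ ρ s) {u : S} (hu : u ∈ D') :
    ∑ s ∈ D', r s + (ρ u - r u - D'.card * c) ≤ ∑ s ∈ D', ρ s := by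
  classical
  have herase : -(D'.card * c) ≤ ∑ s ∈ D'.erase u, (ρ s - r s) :=
    calc -(D'.card * c) ≤ (D'.erase u).card • (-c) := by
          rw [nsmul_eq_mul, mul_neg]
          gcongr
          exact Finset.erase_subset u D'
      _ ≤ _ := Finset.card_nsmul_le_sum _ _ _ fun s hs => by
          linarith [h s (Finset.mem_of_mem_erase hs)]
  have hsum := Finset.sum_erase_add D' (fun s => ρ s - r s) hu
  rw [Finset.sum_sub_distrib (s := D')] at hsum
  linarith

lemma exists_isBinRates [Finite S] {R : S → ℝ} (hR : ∀ s, 0 ≤ R s) (r : S → ℝ)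
    {ε : ℝ} (hε : 0 < ε) : ∃ g > 0, ∃ ρ l, IsBinRates R r ε g ρ l := by
  classical
  have := Fintype.ofFinite S
  obtain ⟨δ, hδ, hδε, hδR⟩ := exists_pos_le_of_pos R hε
  set c := (Fintype.card S : ℝ)
  have hc : 0 ≤ c := by positivity
  set g := δ / (2 * c + 4) with hg
  have hgδ : (2 * c + 4) * g = δ := by rw [hg]; field_simp
  have hg0 : 0 < g := by positivity
  refine ⟨g, hg0, fun s => if R s = 0 then r s - 2 * g else r s + (2 * c + 2) * g,
    fun s => if R s = 0 then 0 else R s - δ, fun s => ?_, fun h => if_pos h, fun s => ?_,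
    fun s => ?_, fun {D' u} hu hRu => ?_⟩
  · split_ifs with h
    · rfl
    · linarith [hδR s ((hR s).lt_of_ne' h)]
  · split_ifs <;> linarith
  · split_ifs <;> linarith
  · refine le_trans ?_ (sum_add_le_sum_of_sub_le (r := r) (c := 2 * g) (by positivity)
      (fun s _ => ?_) hu)
    · have hcard : (D'.card : ℝ) ≤ c := Nat.cast_le.2 (Finset.card_le_univ D')
      simp only [if_neg hRu]
      nlinarith
    · have : 0 ≤ (2 * c + 2) * g := by positivity
      split_ifs <;> linarith

namespace IsBinRates

variable {R r ρ l : S → ℝ} {ε g : ℝ} (h : IsBinRates R r ε g ρ l) {s : S}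
include h

lemma rate_eq_zero (hr : 0 ≤ r s) (hg : 0 < g) (hs : ρ s ≤ 0) : R s = 0 := by
  by_contra hR
  have := h.sum_add_le (Finset.mem_singleton_self s) hR
  simp only [Finset.sum_singleton] at this
  linarith

lemma ceil_eq_one (hR : R s = 0) (n : ℕ) : ⌈(2 : ℝ) ^ (n * l s)⌉₊ = 1 :=
  ceil_two_rpow_eq_one (by rw [h.eq_zero hR, mul_zero])

lemma ceil_mul_ceil_eq_one (hr : 0 ≤ r s) (hg : 0 < g) (hs : ρ s ≤ 0) (n : ℕ) :
    ⌈(2 : ℝ) ^ (n * ρ s)⌉₊ * ⌈(2 : ℝ) ^ (n * l s)⌉₊ = 1 := by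
  rw [h.ceil_eq_one (h.rate_eq_zero hr hg hs), mul_one]
  exact ceil_two_rpow_eq_one (mul_nonpos_of_nonneg_of_nonpos n.cast_nonneg hs)

lemma ceil_mul_ceil_le (hs : 0 < ρ s) (n : ℕ) :
    (⌈(2 : ℝ) ^ (n * ρ s)⌉₊ * ⌈(2 : ℝ) ^ (n * l s)⌉₊ : ℝ) ≤
      4 * 2 ^ (n * (R s + r s - 2 * g)) :=
  calc (⌈(2 : ℝ) ^ (n * ρ s)⌉₊ * ⌈(2 : ℝ) ^ (n * l s)⌉₊ : ℝ)
      ≤ (2 * 2 ^ (n * ρ s)) * (2 * 2 ^ (n * l s)) :=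
        mul_le_mul (ceil_two_rpow_le (by positivity))
          (ceil_two_rpow_le (mul_nonneg n.cast_nonneg (h.nonneg s))) (by positivity)
          (by positivity)
    _ = 4 * 2 ^ (n * (ρ s + l s)) := by
        rw [mul_add, Real.rpow_add two_pos]
        ring
    _ ≤ 4 * 2 ^ (n * (R s + r s - 2 * g)) := by
        gcongr
        · exact one_le_two
        · exact h.add_le s

lemma le_prod_ceil {D' : Finset S} {u : S} (hu : u ∈ D') (hRu : R u ≠ 0) (n : ℕ) :
    (2 : ℝ) ^ (n * (∑ s ∈ D', r s + 2 * g)) ≤ ∏ s ∈ D', (⌈(2 : ℝ) ^ (n * ρ s)⌉₊ : ℝ) :=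
  calc (2 : ℝ) ^ (n * (∑ s ∈ D', r s + 2 * g)) ≤ 2 ^ (n * ∑ s ∈ D', ρ s) := by
        gcongr
        · exact one_le_two
        · exact h.sum_add_le hu hRu
    _ = ∏ s ∈ D', (2 : ℝ) ^ (n * ρ s) := by rw [Finset.mul_sum, Real.rpow_sum_of_pos two_pos]
    _ ≤ _ := Finset.prod_le_prod (fun _ _ => by positivity) fun s _ => Nat.le_ceil _

end IsBinRates

end BinRates

section Exponents

lemma prod_card_le {S : Type*} [Fintype S] {R r : S → ℝ} {g : ℝ} (hg : 0 ≤ g) {n : ℕ}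
    {κ : S → Type*} [∀ s, Fintype (κ s)] {S' : Finset S} (hS' : S'.Nonempty)
    (hκ : ∀ s ∈ S', (Fintype.card (κ s) : ℝ) ≤ 4 * 2 ^ (n * (R s + r s - 2 * g))) :
    ∏ s ∈ S', (Fintype.card (κ s) : ENNReal) ≤
      ENNReal.ofReal (4 ^ Fintype.card S * 2 ^ (n * (∑ s ∈ S', (R s + r s) - 2 * g))) := by
  have hcard : (1 : ℝ) ≤ S'.card := Nat.one_le_cast.2 hS'.card_pos
  rw [← Nat.cast_prod, ← ENNReal.ofReal_natCast]
  refine ENNReal.ofReal_le_ofReal ?_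
  push_cast
  calc ∏ s ∈ S', (Fintype.card (κ s) : ℝ)
      ≤ ∏ s ∈ S', (4 * (2 : ℝ) ^ (n * (R s + r s - 2 * g))) :=
        Finset.prod_le_prod (fun _ _ => by positivity) hκ
    _ = 4 ^ S'.card * 2 ^ (n * (∑ s ∈ S', (R s + r s) - S'.card * (2 * g))) := by
        rw [Finset.prod_mul_distrib, Finset.prod_const, ← Real.rpow_sum_of_pos two_pos,
          ← Finset.mul_sum, Finset.sum_sub_distrib, Finset.sum_const, nsmul_eq_mul]
    _ ≤ 4 ^ Fintype.card S * 2 ^ (n * (∑ s ∈ S', (R s + r s) - 2 * g)) := by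
        have hg' : 2 * g ≤ S'.card * (2 * g) := le_mul_of_one_le_left (by positivity) hcard
        gcongr ?_ ^ ?_ * ?_ ^ (_ * ?_)
        · norm_num
        · exact Finset.card_le_univ S'
        · exact one_le_two
        · linarith

lemma prod_inv_mul_inv_le {S : Type*} {C : S → ℕ} {r : S → ℝ} {g : ℝ} {n : ℕ} {D' : Finset S}
    (h : (2 : ℝ) ^ (n * (∑ s ∈ D', r s + 2 * g)) ≤ ∏ s ∈ D', (C s : ℝ)) :
    (∏ s ∈ D', (C s : ENNReal)⁻¹) * (ENNReal.ofReal (2 ^ (-(n * (∑ s ∈ D', r s + g)))))⁻¹ ≤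
      ENNReal.ofReal (2 ^ (-(n * g))) := by
  have hpos : 0 < ∏ s ∈ D', (C s : ℝ) := lt_of_lt_of_le (by positivity) h
  have hprod : ∏ s ∈ D', (C s : ENNReal)⁻¹ = (ENNReal.ofReal (∏ s ∈ D', (C s : ℝ)))⁻¹ := by
    rw [← ENNReal.prod_inv_distrib fun _ _ _ _ _ => .inr (ENNReal.natCast_ne_top _),
      ENNReal.ofReal_prod_of_nonneg fun _ _ => by positivity]
    simp only [ENNReal.ofReal_natCast]
  rw [hprod, ← ENNReal.ofReal_inv_of_pos hpos, ← ENNReal.ofReal_inv_of_pos (by positivity),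
    ← ENNReal.ofReal_mul (by positivity)]
  refine ENNReal.ofReal_le_ofReal ?_
  calc (∏ s ∈ D', (C s : ℝ))⁻¹ * (2 ^ (-(n * (∑ s ∈ D', r s + g))))⁻¹
      ≤ (2 ^ (n * (∑ s ∈ D', r s + 2 * g)))⁻¹ * (2 ^ (-(n * (∑ s ∈ D', r s + g))))⁻¹ := by
        gcongr
    _ = 2 ^ (-(n * g)) := by
        rw [← Real.rpow_neg two_pos.le, ← Real.rpow_neg two_pos.le, ← Real.rpow_add two_pos]
        ring_nf

lemma tendsto_pow_mul_ofReal_two_rpow_neg {g : ℝ} (hg : 0 < g) (m : ℕ) :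
    Tendsto (fun n : ℕ => 2 ^ m * ENNReal.ofReal (4 ^ m * 2 ^ (-(n * g)))) atTop (𝓝 0) := by
  simpa [ENNReal.ofReal_mul, ← mul_assoc] using
    ENNReal.Tendsto.const_mul (tendsto_ofReal_two_rpow_neg hg) (.inr (by finiteness :
      2 ^ m * ENNReal.ofReal (4 ^ m) ≠ ⊤))

lemma eventually_sum_add_sum_lt {α β ι : Type*} [Fintype α] (t : Finset β) {u : Filter ι}
    {a : ι → α → ENNReal} {b : ι → β → ENNReal} {c : ι → ENNReal}
    (ha : ∀ i, Tendsto (a · i) u (𝓝 0)) (hb : ∀ i ∈ t, Tendsto (b · i) u (𝓝 0))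
    (hc : Tendsto c u (𝓝 0)) {η ε : ℝ} (hη : 0 < η) (h : t.card * η < ε) :
    ∀ᶠ n in u, ∑ i, a n i + ∑ i ∈ t,
      (b n i + ENNReal.ofReal η + (c n + b n i) / ENNReal.ofReal η) < ENNReal.ofReal ε := by
  have hη' : ENNReal.ofReal η ≠ 0 := (ENNReal.ofReal_pos.2 hη).ne'
  have hlim := (tendsto_finsetSum Finset.univ fun i _ => ha i).add
    (tendsto_finsetSum t fun i hi => ((hb i hi).add_const (ENNReal.ofReal η)).add
      (ENNReal.Tendsto.div_const (hc.add (hb i hi)) (.inr hη')))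
  refine hlim.eventually_lt_const ?_
  simp only [Finset.sum_const_zero, zero_add, ENNReal.zero_div, add_zero, Finset.sum_const,
    nsmul_eq_mul]
  rw [← ENNReal.ofReal_natCast, ← ENNReal.ofReal_mul (by positivity)]
  exact (ENNReal.ofReal_lt_ofReal_iff ((by positivity : 0 ≤ t.card * η).trans_lt h)).2 h

end Exponents

section Achievability

variable {S I J : Type*} [Fintype S] [Fintype I] [DecidableEq S] [DecidableEq I]
  {X : I → Type*} {Y : ℕ → J → Type*} [∀ i, Fintype (X i)] [∀ n j, MeasurableSpace (Y n j)]
  {A : Finset (S × I)} {D : J → Finset S} (Z : AuxSources A X) (W : Channel X Y)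

/-- The conditional law of the sources `D'` given the output at decoder `j` and the remaining
sources demanded there. The typicality decoders test for its values. -/
def AuxSources.posterior (D : J → Finset S) (n : ℕ) (j : J) (D' : Finset S) :
    Kernel (Y n j × (∀ s : ↥(D j \ D'), Z.Alph n s)) (∀ s : D', Z.Alph n s) :=
  condDistrib (fun ω : (∀ s, Z.Alph n s) × (∀ j, Y n j) => D'.restrict ω.1)
    (fun ω => (ω.2 j, (D j \ D').restrict ω.1)) (Z.joint W n)

instance (n : ℕ) (j : J) (D' : Finset S) : IsMarkovKernel (Z.posterior W D n j D') := by
  unfold AuxSources.posterior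
  infer_instance

lemma AuxSources.joint_posterior_lt_le {n : ℕ} (hn : n ≠ 0) (j : J) (D' : Finset S) (θ : ℝ) :
    Z.joint W n {ω | Z.posterior W D n j D' (ω.2 j, (D j \ D').restrict ω.1) {D'.restrict ω.1} <
        ENNReal.ofReal (2 ^ (-(n * θ)))} ≤
      Z.joint W n {ω | θ < condInfo (Z.joint W) (fun _ ω => D'.restrict ω.1)
        (fun _ ω => (ω.2 j, (D j \ D').restrict ω.1)) n ω} := by
  have h0 : Z.joint W n
      {ω | Z.posterior W D n j D' (ω.2 j, (D j \ D').restrict ω.1) {D'.restrict ω.1} = 0} = 0 :=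
    measure_condDistrib_eq_zero (by fun_prop) (by fun_prop)
  refine measure_mono_ae ?_
  filter_upwards [measure_eq_zero_iff_ae_notMem.1 h0] with ω hω hlt
  exact (lt_condInfo_iff (μ := Z.joint W) (U := fun _ ω => D'.restrict ω.1)
    (V := fun _ ω => (ω.2 j, (D j \ D').restrict ω.1)) hn hω).2 hlt

lemma AuxSources.tendsto_not_isLikely {r : S → ℝ} {j : J} (h : ∀ D' ⊆ D j, D'.Nonempty →
      supEntropy (Z.joint W) (fun _ ω => D'.restrict ω.1)
          (fun _ ω => (ω.2 j, (D j \ D').restrict ω.1)) ≤ ((∑ s ∈ D', r s : ℝ) : EReal))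
    {g : ℝ} (hg : 0 < g) (N : Finset S) :
    Tendsto (fun n : ℕ => Z.joint W n {ω | ¬ IsLikely (Z.posterior W D n)
      (fun D' => ENNReal.ofReal (2 ^ (-(n * (∑ s ∈ D', r s + g))))) N j (ω.2 j) ω.1})
      atTop (𝓝 0) := by
  have hlim : Tendsto (fun n : ℕ => ∑ D' ∈ (D j).powerset with D'.Nonempty,
      Z.joint W n {ω | ∑ s ∈ D', r s + g < condInfo (Z.joint W) (fun _ ω => D'.restrict ω.1)
          (fun _ ω => (ω.2 j, (D j \ D').restrict ω.1)) n ω}) atTop (𝓝 0) := by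
    rw [← Finset.sum_const_zero]
    refine tendsto_finsetSum _ fun D' hD' => ?_
    obtain ⟨hD', hne⟩ := Finset.mem_filter.1 hD'
    exact tendsto_of_pLimsup_lt ((h D' (Finset.mem_powerset.1 hD') hne).trans_lt
      (EReal.coe_lt_coe_iff.2 (lt_add_of_pos_right _ hg)))
  refine tendsto_of_tendsto_of_tendsto_of_le_of_le' tendsto_const_nhds hlim
    (.of_forall fun _ => zero_le) ?_
  filter_upwards [eventually_ne_atTop 0] with n hn
  calc Z.joint W n {ω | ¬ IsLikely (Z.posterior W D n)
        (fun D' => ENNReal.ofReal (2 ^ (-(n * (∑ s ∈ D', r s + g))))) N j (ω.2 j) ω.1}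
      ≤ Z.joint W n (⋃ D' ∈ ({D' ∈ (D j).powerset | D'.Nonempty} : Finset (Finset S)),
          {ω | Z.posterior W D n j D' (ω.2 j, (D j \ D').restrict ω.1) {D'.restrict ω.1} <
            ENNReal.ofReal (2 ^ (-(n * (∑ s ∈ D', r s + g))))}) := by
        refine measure_mono fun ω (hω : ¬ IsLikely _ _ N j (ω.2 j) ω.1) => ?_
        simp only [IsLikely, not_forall, not_le] at hω
        obtain ⟨D', hD', hN, hlt⟩ := hω
        obtain ⟨u, hu, -⟩ := Finset.not_subset.1 hN
        exact Set.mem_biUnion (Finset.mem_coe.2 (Finset.mem_filter.2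
          ⟨Finset.mem_powerset.2 hD', u, hu⟩)) hlt
    _ ≤ ∑ D' ∈ (D j).powerset with D'.Nonempty, Z.joint W n
          {ω | Z.posterior W D n j D' (ω.2 j, (D j \ D').restrict ω.1) {D'.restrict ω.1} <
            ENNReal.ofReal (2 ^ (-(n * (∑ s ∈ D', r s + g))))} := measure_biUnion_finset_le _ _
    _ ≤ _ := Finset.sum_le_sum fun D' _ => Z.joint_posterior_lt_le W hn j D' _

lemma AuxSources.toOuterMeasure_law (n : ℕ) (E : Set (∀ s, Z.Alph n s)) :
    (Z.law n).toOuterMeasure E = Z.joint W n {ω | ω.1 ∈ E ∧ Z.law n ω.1 ≠ 0} := by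
  rw [← PMF.toOuterMeasure_apply_inter_support,
    ← PMF.toMeasure_apply_eq_toOuterMeasure_apply _ .of_discrete, ← Z.map_fst_joint W,
    Measure.map_apply measurable_fst .of_discrete]
  rfl

lemma AuxSources.condInfo_lt_of_not_isSpread {R r : S → ℝ} {g : ℝ} (hg : 0 ≤ g) {P U B : Finset S}
    {n : ℕ} (hn : n ≠ 0) {κ : S → Type*} [∀ s, Fintype (κ s)]
    (hκ : ∀ s ∈ B, (Fintype.card (κ s) : ℝ) ≤ 4 * 2 ^ (n * (R s + r s - 2 * g)))
    {ω : (∀ s, Z.Alph n s) × (∀ j, Y n j)} (hω₀ : Z.law n ω.1 ≠ 0)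
    (hω : ¬ IsSpread (Z.law n) κ P U B
      (ENNReal.ofReal (4 ^ Fintype.card S * 2 ^ (-(n * g)))) ω.1) :
    ∃ S' ⊆ P ∩ B, S'.Nonempty ∧ condInfo (Z.joint W) (fun _ ω => S'.restrict ω.1)
      (fun _ ω => U.restrict ω.1) n ω < ∑ s ∈ S', (R s + r s) - g := by
  simp only [IsSpread, not_forall, not_le] at hω
  obtain ⟨S', hS', hne, hlt⟩ := hω
  refine ⟨S', hS', hne, condInfo_lt_of_lt_measure hn ?_⟩
  rw [Z.condDistrib_restrict W n S' U ω.1 (marg_ne_zero U hω₀)]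
  by_contra! hle
  refine hlt.not_ge ?_
  calc marg (Z.law n) (S' ∪ U) ω.1 / marg (Z.law n) U ω.1 * ∏ s ∈ S', (Fintype.card (κ s) : ENNReal)
      ≤ ENNReal.ofReal (2 ^ (-(n * (∑ s ∈ S', (R s + r s) - g)))) *
        ENNReal.ofReal (4 ^ Fintype.card S * 2 ^ (n * (∑ s ∈ S', (R s + r s) - 2 * g))) :=
        mul_le_mul' hle
          (prod_card_le hg hne fun s hs => hκ s (Finset.mem_of_mem_inter_right (hS' hs)))
    _ = ENNReal.ofReal (4 ^ Fintype.card S * 2 ^ (-(n * g))) := by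
        rw [← ENNReal.ofReal_mul (by positivity), mul_left_comm, ← Real.rpow_add two_pos]
        ring_nf

lemma AuxSources.tendsto_not_isSpread {R r : S → ℝ} {P U B : Finset S}
    (h : ∀ S' ⊆ P ∩ B, S'.Nonempty → ((∑ s ∈ S', (R s + r s) : ℝ) : EReal) ≤
      infEntropy (Z.joint W) (fun _ ω => S'.restrict ω.1) (fun _ ω => U.restrict ω.1))
    {g : ℝ} (hg : 0 < g) {κ : ℕ → S → Type*} [∀ n s, Fintype (κ n s)]
    (hκ : ∀ n : ℕ, ∀ s ∈ B, (Fintype.card (κ n s) : ℝ) ≤ 4 * 2 ^ (n * (R s + r s - 2 * g))) :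
    Tendsto (fun n : ℕ => (Z.law n).toOuterMeasure {z | ¬ IsSpread (Z.law n) (κ n) P U B
      (ENNReal.ofReal (4 ^ Fintype.card S * 2 ^ (-(n * g)))) z}) atTop (𝓝 0) := by
  have hlim : Tendsto (fun n : ℕ => ∑ S' ∈ (P ∩ B).powerset with S'.Nonempty,
      Z.joint W n {ω | condInfo (Z.joint W) (fun _ ω => S'.restrict ω.1)
          (fun _ ω => U.restrict ω.1) n ω < ∑ s ∈ S', (R s + r s) - g}) atTop (𝓝 0) := by
    rw [← Finset.sum_const_zero]
    refine tendsto_finsetSum _ fun S' hS' => ?_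
    obtain ⟨hS', hne⟩ := Finset.mem_filter.1 hS'
    exact tendsto_of_lt_pLiminf ((EReal.coe_lt_coe_iff.2 (sub_lt_self _ hg)).trans_le
      (h S' (Finset.mem_powerset.1 hS') hne))
  refine tendsto_of_tendsto_of_tendsto_of_le_of_le' tendsto_const_nhds hlim
    (.of_forall fun _ => zero_le) ?_
  filter_upwards [eventually_ne_atTop 0] with n hn
  rw [Z.toOuterMeasure_law W n]
  refine (measure_mono fun ω hω => ?_).trans (measure_biUnion_finset_le _ _)
  obtain ⟨S', hS', hne, hlt⟩ := Z.condInfo_lt_of_not_isSpread W hg.le hn (hκ n) hω.2 hω.1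
  exact Set.mem_biUnion (Finset.mem_coe.2 (Finset.mem_filter.2
    ⟨Finset.mem_powerset.2 hS', hne⟩)) hlt

variable [Fintype J]

lemma AuxSources.eventually_hasGoodCode {R r ρ l : S → ℝ} {ε g : ℝ} (hε : 0 < ε) (hg : 0 < g)
    (hr : ∀ s, 0 ≤ r s) (h : IsBinRates R r ε g ρ l)
    (hinf : ∀ I' ∈ accessFamily A, ∀ S' ⊆ privateMessages A I', S'.Nonempty →
      (∀ s ∈ S', 0 < ρ s) → ((∑ s ∈ S', (R s + r s) : ℝ) : EReal) ≤
        infEntropy (Z.joint W) (fun _ ω => S'.restrict ω.1)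
          (fun _ ω => (publicMessages A I').restrict ω.1))
    (hsup : ∀ j, ∀ D' ⊆ D j, D'.Nonempty →
      supEntropy (Z.joint W) (fun _ ω => D'.restrict ω.1)
          (fun _ ω => (ω.2 j, (D j \ D').restrict ω.1)) ≤ ((∑ s ∈ D', r s : ℝ) : EReal)) :
    ∀ᶠ n in atTop, HasGoodCode A D W R n ε := by
  classical
  set N : Finset S := {s | R s = 0}
  set B : Finset S := {s | 0 < ρ s}
  set C : ℕ → S → ℕ := fun n s => ⌈(2 : ℝ) ^ (n * ρ s)⌉₊
  set L : ℕ → S → ℕ := fun n s => ⌈(2 : ℝ) ^ (n * l s)⌉₊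
  have : ∀ n s, NeZero (C n s) := fun n s => ⟨ceil_two_rpow_ne_zero _⟩
  have : ∀ n s, NeZero (L n s) := fun n s => ⟨ceil_two_rpow_ne_zero _⟩
  have hN : ∀ n, ∀ s ∈ N, L n s = 1 := fun n s hs =>
    h.ceil_eq_one (Finset.mem_filter.1 hs).2 n
  have hB : ∀ n, ∀ s ∉ B, C n s * L n s = 1 := fun n s hs =>
    h.ceil_mul_ceil_eq_one (hr s) hg (by simpa [B] using hs) n
  have hspread := fun I' (hI' : I' ∈ accessFamily A) =>
    Z.tendsto_not_isSpread W (B := B) (fun S' hS' hne => hinf I' hI' S'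
      (hS'.trans Finset.inter_subset_left) hne fun s hs =>
        (Finset.mem_filter.1 (Finset.mem_of_mem_inter_right (hS' hs))).2) hg
      (κ := fun n s => Fin (C n s) × Fin (L n s)) fun n s hs => by
        rw [Fintype.card_prod, Fintype.card_fin, Fintype.card_fin, Nat.cast_mul]
        exact h.ceil_mul_ceil_le (Finset.mem_filter.1 hs).2 n
  have hexp := tendsto_ofReal_two_rpow_neg hg
  have hdecode := fun j => (Z.tendsto_not_isLikely W (hsup j) hg N).add
    (tendsto_finsetSum {D' ∈ (D j).powerset | ¬ D' ⊆ N} fun _ _ => hexp)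
  simp only [Finset.sum_const_zero, add_zero] at hdecode
  obtain ⟨η, hη, hηε⟩ := exists_pos_mul_lt hε ((accessFamily A).card : ℝ)
  filter_upwards [eventually_sum_add_sum_lt _ hdecode hspread
      (tendsto_pow_mul_ofReal_two_rpow_neg hg _) hη hηε,
    eventually_ne_atTop 0] with n hlt hn
  obtain ⟨E, hE, herr⟩ := exists_code Z n W (C := C n) (L := L n) (Z.posterior W D n) B (hB n)
    (hN n) (τ := fun D' => ENNReal.ofReal (2 ^ (-(n * (∑ s ∈ D', r s + g)))))
    (fun D' => (ENNReal.ofReal_pos.2 (by positivity)).ne')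
    (fun D' => ENNReal.ofReal_ne_top) (ENNReal.ofReal (4 ^ Fintype.card S * 2 ^ (-(n * g)))) hη
  refine ⟨E, fun s => (h.sub_le s).trans (hE ▸ le_logb_ceil_div hn (l s)),
    herr.trans (le_trans ?_ hlt.le)⟩
  refine add_le_add (Finset.sum_le_sum fun j _ => add_le_add le_rfl
    (Finset.sum_le_sum fun D' hD' => ?_)) le_rfl
  obtain ⟨u, hu, huN⟩ := Finset.not_subset.1 (Finset.mem_filter.1 hD').2
  exact prod_inv_mul_inv_le (h.le_prod_ceil hu (by simpa [N] using huN) n)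

theorem isAchievable_of_mem_RIT {R : S → ℝ} (hR : R ∈ RIT A D W) : IsAchievable A D W R := by
  classical
  obtain ⟨hR₀, Z, r, hinf, hsup⟩ := hR
  refine isAchievable_of_eventually_hasGoodCode hR₀ fun ε hε => ?_
  -- An undemanded `r s` is unconstrained and may be negative: such messages are coded at rate zero.
  let Dem : Finset S := Finset.univ.biUnion D
  have hDem : ∀ j, ∀ s ∈ D j, s ∈ Dem := fun j s hs =>
    Finset.mem_biUnion.2 ⟨j, Finset.mem_univ j, hs⟩
  let R' : S → ℝ := fun s => if s ∈ Dem then R s else 0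
  let r' : S → ℝ := fun s => if s ∈ Dem then r s else 0
  have hsum : ∀ s ∈ Dem, R' s + r' s = R s + r s := fun s hs => by simp only [R', r', if_pos hs]
  have hR' : ∀ s, 0 ≤ R' s := fun s => by
    simp only [R']
    split_ifs
    exacts [hR₀ s, le_rfl]
  have hr' : ∀ s, 0 ≤ r' s := fun s => by
    simp only [r']
    split_ifs with hs
    · obtain ⟨j, -, hs⟩ := Finset.mem_biUnion.1 hs
      simpa using (supEntropy_nonneg _ _ _).trans
        (hsup j {s} (Finset.singleton_subset_iff.2 hs) (Finset.singleton_nonempty s))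
    · exact le_rfl
  obtain ⟨g, hg, ρ, l, h⟩ := exists_isBinRates hR' r' hε
  have hρ : ∀ s, 0 < ρ s → s ∈ Dem := fun s hs => by
    by_contra hsD
    have := h.add_le s
    simp only [R', r', if_neg hsD] at this
    linarith [h.nonneg s]
  have hgood : ∀ᶠ n in atTop, HasGoodCode A D W R' n ε := by
    refine Z.eventually_hasGoodCode W hε hg hr' h (fun I' hI' S' hS' hne hpos => ?_)
      fun j D' hD' hne => ?_
    · rw [Finset.sum_congr rfl fun s hs => hsum s (hρ s (hpos s hs))]
      exact hinf I' hI' S' hS' hne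
    · rw [Finset.sum_congr rfl fun s hs => if_pos (hDem j s (hD' hs))]
      exact hsup j D' hD' hne
  filter_upwards [hgood, eventually_ne_atTop 0] with n hn hn0
  exact hn.of_eq_on_demanded hn0 hε fun j s hs => (if_pos (hDem j s hs)).symm

end Achievability

end MultiChannel

end

theorem theorem1 {S I J : Type*} [Fintype S] [Fintype I] [Fintype J]
    [DecidableEq S] [DecidableEq I]
    {X : I → Type*} [∀ i, Fintype (X i)]
    {Y : ℕ → J → Type*} [∀ n j, MeasurableSpace (Y n j)]
    (A : Finset (S × I)) (D : J → Finset S) (W : MultiChannel.Channel X Y) :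
    MultiChannel.ROP A D W = MultiChannel.RIT A D W := by
  exact Set.Subset.antisymm
    (fun R hR => MultiChannel.mem_RIT_of_isAchievable (MultiChannel.isAchievable_of_mem_ROP hR))
    (fun R hR => subset_closure (MultiChannel.isAchievable_of_mem_RIT W hR))
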